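/- **Definitions.** A *Peano continuum* is a separable, compact, connected, locally connected metrizable space. An *E-graph* (graph with ends) is a Hausdorff space decomposed into $0$-cells (vertices) and open $1$-cells (edges), such that the decomposition is locally finite and the closure of each edge consists of the edge and of vertices and is homeomorphic to $[-1,1]$ or to $\{t\in\mathbb R\mid t\ge 0\}$. An isomorphism of E-graphs is a homeomorphism that maps vertices to vertices and edges to edges. For a continuous function $c:X\to\mathbb R$, the connected components of the level sets of $c$ are called contours; the *Reeb space* $R_c$ is the quotient space of $X$ obtained by collapsing each contour to a point, and $q_c:X\to R_c$ is the quotient map. If $X$ is a smooth manifold and $c$ is smooth, a contour is *critical* if it contains a critical point of $c$. Let $c_0:\mathbb R\to\mathbb R$ be defined by $c_0(x)=e^{-1/x^2}\,x\sin^2(1/x)$ for $x\ne0$ and $c_0(0)=0$. **Theorem.** There are real numbers $p_1,p_2,r_1,r_2,r_{1,2}>0$ and a Peano continuum $G_2$ with the following properties. 1. $G_2$ is not homeomorphic to any E-graph. There is exactly one point $p\in G_2$ such that $G_2-\{p\}$ is homeomorphic to an E-graph. The space $G_2-\{p\}$ is non-compact, $G_2$ is its one-point compactification with $p$ as the point at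 infinity, and $G_2-\{p\}$ carries a structure of an E-graph, fixed from now on, for which 2 holds. 2. Let $m_1,m_2>1$ be integers, $m=m_1+m_2$, and write the points of $\mathbb R^{m+2}$ as $(x_1,x_2,y,z)$ with $y\in\mathbb R^{m_1}$, $z\in\mathbb R^{m_2}$. Let $e_{m_1,m_2}:\mathbb R^{m+2}\to\mathbb R^2$ be the map $$e_{m_1,m_2}(x_1,x_2,y,z)=\Bigl(x_1-c_0(x_2)-\sum_{j=1}^{m_1}y_j^2,\; r_{1,2}-\frac{(x_1-p_1)^2}{r_1}-\frac{(x_2-p_2)^2}{r_2}-\sum_{j=1}^{m_2}z_j^2\Bigr).$$ Then $e_{m_1,m_2}$ is smooth, and real analytic outside some set of Lebesgue measure $0$. Its zero set $X=e_{m_1,m_2}^{-1}(0)$ is a compact, connected smooth submanifold of $\mathbb R^{m+2}$ of dimension $m$ that contains the origin $0$. Let $c:X\to\mathbb R$ be the restriction of the projection $(x_1,x_2,y,z)\mapsto x_1$. Then there is a homeomorphism $R_c\to G_2$; the space $q_c(X-\{0\})\subset R_c$ has the structure of an E-graph whose vertices are exactly the points representing the contours that contain a critical point of $c$ in $X-\{0\}$;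 and the homeomorphism can be chosen so that it restricts to an isomorphism of this E-graph onto the E-graph $G_2-\{p\}$. -/

import Mathlib

open Set Topology MeasureTheory
open scoped ContDiff

noncomputable section

/-- A Peano continuum: a separable, compact, connected and locally connected metrizable space. -/
structure IsPeanoContinuum (Y : Type*) [TopologicalSpace Y] : Prop where
  separable : TopologicalSpace.SeparableSpace Y
  compact : CompactSpace Y
  connected : ConnectedSpace Y
  locallyConnected : LocallyConnectedSpace Y
  metrizable : TopologicalSpace.MetrizableSpace Y

/-- The structure of an E-graph ("graph with ends") on a topological space `Y`: a locally finite
decomposition of the Hausdorff space `Y` into `0`-cells (vertices) and open `1`-cells (edges), such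
that the closure of each edge is homeomorphic to the closed interval `[-1, 1]` or to the half-line
`{t | 0 ≤ t}`, and is obtained from the edge by adding vertices only.

When all closures are closed intervals, this is a locally finite CW complex of dimension at most
`1` without loops (local finiteness gives the weak topology). A closed half-line is not the closure
of a cell of a CW complex in the strict sense, hence the notion is spelled out by cells. -/
structure EGraph (Y : Type*) [TopologicalSpace Y] where
  /-- the set of vertices -/
  vertices : Set Y
  /-- the set of (open) edges -/
  edges : Set (Set Y)
  t2 : T2Space Y
  disjoint_vertices : ∀ e ∈ edges, Disjoint e vertices
  disjoint_edges : edges.PairwiseDisjoint id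
  cover : vertices ∪ ⋃₀ edges = univ
  edge_homeo : ∀ e ∈ edges, Nonempty (e ≃ₜ ℝ)
  closure_diff_subset : ∀ e ∈ edges, closure e \ e ⊆ vertices
  closure_homeo : ∀ e ∈ edges,
    Nonempty (closure e ≃ₜ Icc (-1 : ℝ) 1) ∨ Nonempty (closure e ≃ₜ Ici (0 : ℝ))
  locally_finite : ∀ y : Y, ∃ U ∈ 𝓝 y,
    (vertices ∩ U).Finite ∧ {e ∈ edges | (closure e ∩ U).Nonempty}.Finite

/-- A homeomorphism is an isomorphism of E-graphs if it maps the vertices onto the vertices and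
the edges onto the edges. -/
def EGraph.IsIso {Y Y' : Type*} [TopologicalSpace Y] [TopologicalSpace Y']
    (Γ : EGraph Y) (Γ' : EGraph Y') (φ : Y ≃ₜ Y') : Prop :=
  φ '' Γ.vertices = Γ'.vertices ∧ (fun e : Set Y => φ '' e) '' Γ.edges = Γ'.edges

/-- `Y` is homeomorphic to some E-graph (living in the universe `u`). -/
def HomeomorphicToEGraph.{u, v} (Y : Type v) [TopologicalSpace Y] : Prop :=
  ∃ (W : Type u) (_ : TopologicalSpace W), Nonempty (EGraph W) ∧ Nonempty (Y ≃ₜ W)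

/-- Two points are equivalent if they lie in the same connected component of the same level set
of `c`. -/
def reebSetoid {X Y : Type*} [TopologicalSpace X] (c : X → Y) : Setoid X where
  r x y := y ∈ connectedComponentIn (c ⁻¹' {c x}) x
  iseqv :=
    { refl := fun x => mem_connectedComponentIn (by simp)
      symm := fun {x y} h => by
        have hy : y ∈ c ⁻¹' {c x} := connectedComponentIn_subset _ _ h
        rw [show c y = c x from hy, ← connectedComponentIn_eq h]
        exact mem_connectedComponentIn (by simp)
      trans := fun {x y z} h h' => by
        have hy : y ∈ c ⁻¹' {c x} := connectedComponentIn_subset _ _ h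
        rw [show c y = c x from hy, ← connectedComponentIn_eq h] at h'
        exact h' }

/-- The Reeb space of `c`, with the quotient topology. -/
abbrev ReebSpace {X Y : Type*} [TopologicalSpace X] (c : X → Y) : Type _ :=
  Quotient (reebSetoid c)

/-- The quotient map onto the Reeb space. -/
def reebMap {X Y : Type*} [TopologicalSpace X] (c : X → Y) : X → ReebSpace c :=
  Quotient.mk (reebSetoid c)

/-- `X ⊆ ℝⁿ` is an (embedded) smooth submanifold of dimension `d` without boundary: around each of
its points there is a smooth local diffeomorphism of the ambient space flattening `X` to a
`d`-dimensional coordinate subspace. -/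
def IsSmoothSubmanifold {n : ℕ} (d : ℕ) (X : Set (EuclideanSpace ℝ (Fin n))) : Prop :=
  ∃ k : ℕ, n = d + k ∧ ∀ x ∈ X,
    ∃ φ : OpenPartialHomeomorph (EuclideanSpace ℝ (Fin n))
        (EuclideanSpace ℝ (Fin d) × EuclideanSpace ℝ (Fin k)),
      x ∈ φ.source ∧ ContDiffOn ℝ ∞ φ φ.source ∧ ContDiffOn ℝ ∞ φ.symm φ.target ∧
        ∀ y ∈ φ.source, (y ∈ X ↔ (φ y).2 = 0)

/-- The tangent vectors to `X` at `x`: velocities of smooth curves in `X` through `x`. -/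
def tangentVectors {n : ℕ} (X : Set (EuclideanSpace ℝ (Fin n))) (x : EuclideanSpace ℝ (Fin n)) :
    Set (EuclideanSpace ℝ (Fin n)) :=
  {v | ∃ γ : ℝ → EuclideanSpace ℝ (Fin n), ContDiffAt ℝ ∞ γ 0 ∧ (∀ᶠ t in 𝓝 (0 : ℝ), γ t ∈ X) ∧
    γ 0 = x ∧ HasDerivAt γ v 0}

/-- `x` is a critical point of the restriction to the submanifold `X` of the smooth function `f`. -/
def IsCriticalPointOn {n : ℕ} (X : Set (EuclideanSpace ℝ (Fin n)))
    (f : EuclideanSpace ℝ (Fin n) → ℝ) (x : EuclideanSpace ℝ (Fin n)) : Prop :=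
  x ∈ X ∧ ∀ v ∈ tangentVectors X x, fderiv ℝ f x v = 0

/-- The function `e^{-1/x²} x sin²(1/x)`, extended by the value `0` at `x = 0` (the formula below
has this value there because of the factor `x`). -/
def c₀ (x : ℝ) : ℝ := Real.exp (-(1 / x ^ 2)) * x * Real.sin (1 / x) ^ 2

/-- With coordinates `(x₁, x₂, y, z)` on `ℝ^{m₁+m₂+2}`, where `y` has `m₁` and `z` has `m₂` entries,
the map
`(x₁ - c₀(x₂) - ∑ yⱼ², r₁₂ - ((x₁-p₁)²/r₁ + (x₂-p₂)²/r₂) - ∑ zⱼ²)`. -/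
def eMap (p₁ p₂ r₁ r₂ r₁₂ : ℝ) (m₁ m₂ : ℕ) (x : EuclideanSpace ℝ (Fin (m₁ + m₂ + 2))) :
    EuclideanSpace ℝ (Fin 2) :=
  !₂[x 0 - c₀ (x 1) - ∑ j : Fin m₁, x ⟨2 + j, by have := j.isLt; omega⟩ ^ 2,
    r₁₂ - ((x 0 - p₁) ^ 2 / r₁ + (x 1 - p₂) ^ 2 / r₂)
      - ∑ j : Fin m₂, x ⟨2 + m₁ + j, by have := j.isLt; omega⟩ ^ 2]

/-- The zero set of `eMap`. -/
def zeroManifold (p₁ p₂ r₁ r₂ r₁₂ : ℝ) (m₁ m₂ : ℕ) : Set (EuclideanSpace ℝ (Fin (m₁ + m₂ + 2))) :=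
  eMap p₁ p₂ r₁ r₂ r₁₂ m₁ m₂ ⁻¹' {0}

/-- The restriction of the projection to the first coordinate to the zero set of `eMap`. -/
def cFun (p₁ p₂ r₁ r₂ r₁₂ : ℝ) (m₁ m₂ : ℕ) (x : zeroManifold p₁ p₂ r₁ r₂ r₁₂ m₁ m₂) : ℝ :=
  (x : EuclideanSpace ℝ (Fin (m₁ + m₂ + 2))) 0

end

universe u

/-! Take p₁ = p₂ = 1/(2π), r₁ = r₂ = 1 and r₁₂ = 1/(2π²), so that the second equation describes the
disk whose boundary circle passes through (0, 0), (0, 1/π), (1/π, 0) and (1/π, 1/π). The zero set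
projects to the (x₁, x₂)-plane onto `region`, the part of this disk with c₀(x₂) ≤ x₁. The fibre over
a point is a product of two spheres, in y and in z, possibly of radius 0; these are connected
because m₁, m₂ > 1. Hence the contours of x₁ correspond to the components of the slices of `region`
at fixed x₁ = t.

Such a slice is an interval from which the places with c₀ > t are removed. Between consecutive zeros
of c₀ in (0, 1/π] there is exactly one critical point, a peak, and the peak heights decrease
strictly to 0 towards the origin (`eq_peak`, `strictAnti_c₀_peak`). So the trough on the right of a
peak has a component of its own as long as t is below the height of that peak, and merges with the
component on its left at that height. With M(x₂) the running maximum of c₀ on [0, x₂], clamped to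
[0, 1/π], the number max(t, M(x₂)) tells the components of a slice apart (`c₀_le_of_max_runMax_eq`,
`max_runMax_eq`). Therefore `foldMap` identifies the Reeb space with a comb: a diagonal spine
carrying one tooth for each peak, at the height of the peak (`reebHomeo`).

The free ends of the teeth have to be vertices of any E-graph structure, since edges are open and
look like ℝ, and they accumulate at the tip of the comb, which represents the origin. So the comb is
not an E-graph, nor is its complement of any point but the tip; without the tip it is one
(`IsCombSeq.eGraph`). By `isCriticalPointOn_iff` the critical points of x₁ lie over the zeros and
peaks of c₀ on its graph and over the point of the circle with largest x₁. They represent the free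
ends of the teeth, their junctions with the spine, the top of the spine and, for the origin, the
tip. -/

namespace EGraph

/-! ### E-graphs: transport along homeomorphisms and openness of edges. -/

variable {Y W : Type*} [TopologicalSpace Y] [TopologicalSpace W]

/-- The E-graph structure pulled back along a homeomorphism. -/
def comap (Γ : EGraph W) (φ : Y ≃ₜ W) : EGraph Y where
  vertices := φ ⁻¹' Γ.vertices
  edges := {a | φ '' a ∈ Γ.edges}
  t2 := by
    have := Γ.t2
    exact φ.symm.t2Space
  disjoint_vertices := fun a ha => by
    have h := Γ.disjoint_vertices _ ha
    rw [Set.disjoint_left] at h ⊢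
    exact fun x hx hv => h (mem_image_of_mem φ hx) hv
  disjoint_edges := fun a ha b hb hab => by
    have h := Γ.disjoint_edges ha hb (fun h => hab (φ.injective.image_injective h))
    simp only [Function.onFun, id] at h ⊢
    exact (Set.disjoint_image_iff φ.injective).1 h
  cover := by
    refine eq_univ_of_forall fun y => ?_
    rcases (Γ.cover ▸ mem_univ (φ y) : φ y ∈ Γ.vertices ∪ ⋃₀ Γ.edges) with h | ⟨a, ha, hy⟩
    · exact Or.inl h
    · refine Or.inr ⟨φ ⁻¹' a, ?_, hy⟩
      simpa [image_preimage_eq a φ.surjective] using ha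
  edge_homeo := fun a ha => by
    obtain ⟨ψ⟩ := Γ.edge_homeo _ ha
    exact ⟨(φ.image a).trans ψ⟩
  closure_diff_subset := fun a ha x hx => by
    apply Γ.closure_diff_subset _ ha
    rw [← φ.image_closure]
    refine ⟨mem_image_of_mem φ hx.1, fun h => hx.2 ?_⟩
    obtain ⟨y, hy, hxy⟩ := h
    rwa [← φ.injective hxy]
  closure_homeo := fun a ha => by
    have ψ : closure a ≃ₜ closure (φ '' a) :=
      (φ.image (closure a)).trans (Homeomorph.setCongr (φ.image_closure a))
    rcases Γ.closure_homeo _ ha with ⟨⟨χ⟩⟩ | ⟨⟨χ⟩⟩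
    · exact Or.inl ⟨ψ.trans χ⟩
    · exact Or.inr ⟨ψ.trans χ⟩
  locally_finite := fun y => by
    obtain ⟨U, hU, hv, he⟩ := Γ.locally_finite (φ y)
    refine ⟨φ ⁻¹' U, φ.continuous.continuousAt hU, ?_, ?_⟩
    · exact Set.Finite.preimage (f := φ) φ.injective.injOn hv
    · refine (he.preimage (f := fun a => φ '' a) φ.injective.image_injective.injOn).subset ?_
      rintro a ⟨ha, x, hx, hxU⟩
      exact ⟨ha, φ x, by rw [← φ.image_closure]; exact mem_image_of_mem φ hx, hxU⟩

theorem comap_isIso (Γ : EGraph W) (φ : Y ≃ₜ W) : (Γ.comap φ).IsIso Γ φ := by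
  refine ⟨image_preimage_eq _ φ.surjective, ?_⟩
  ext a
  constructor
  · rintro ⟨b, hb, rfl⟩
    exact hb
  · intro ha
    have h : φ '' (φ ⁻¹' a) = a := image_preimage_eq a φ.surjective
    exact ⟨φ ⁻¹' a, show φ '' (φ ⁻¹' a) ∈ Γ.edges by rwa [h], h⟩

/-- By local finiteness, everything near the point outside the edge lies in finitely many vertices
and closures of other edges. This set is closed and misses the point, because the closure of another
edge adds only vertices to it. -/
theorem isOpen_edge (Γ : EGraph Y) {a : Set Y} (ha : a ∈ Γ.edges) : IsOpen a := by
  have := Γ.t2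
  rw [isOpen_iff_mem_nhds]
  intro y hy
  obtain ⟨U, hU, hv, he⟩ := Γ.locally_finite y
  set F := {e ∈ Γ.edges | (closure e ∩ U).Nonempty}
  have hC : IsClosed ((Γ.vertices ∩ U) ∪ ⋃ b ∈ F \ {a}, closure b) :=
    hv.isClosed.union ((he.subset sdiff_subset).isClosed_biUnion fun _ _ => isClosed_closure)
  have hyv : y ∉ Γ.vertices := Set.disjoint_left.1 (Γ.disjoint_vertices a ha) hy
  have hyC : y ∉ (Γ.vertices ∩ U) ∪ ⋃ b ∈ F \ {a}, closure b := by
    rintro (h | h)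
    · exact hyv h.1
    · simp only [mem_iUnion] at h
      obtain ⟨b, ⟨hb, hba⟩, hyb⟩ := h
      by_cases h : y ∈ b
      · exact Set.disjoint_left.1 (Γ.disjoint_edges hb.1 ha hba) h hy
      · exact hyv (Γ.closure_diff_subset b hb.1 ⟨hyb, h⟩)
  filter_upwards [hU, hC.isOpen_compl.mem_nhds hyC] with z hzU hzC
  rcases (Γ.cover ▸ mem_univ z : z ∈ Γ.vertices ∪ ⋃₀ Γ.edges) with h | ⟨b, hb, hz⟩
  · exact absurd (Or.inl ⟨h, hzU⟩) hzC
  · by_cases hba : b = a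
    · rwa [← hba]
    · refine absurd (Or.inr ?_) hzC
      simp only [mem_iUnion]
      exact ⟨b, ⟨⟨hb, z, subset_closure hz, hzU⟩, hba⟩, subset_closure hz⟩

end EGraph

/-! ### Endpoints, a topological invariant that forces vertices. -/

/-- A point with arbitrarily small neighbourhoods which stay preconnected when the point is
removed. -/
def IsEndPoint {Y : Type*} [TopologicalSpace Y] (y : Y) : Prop :=
  ∀ U ∈ 𝓝 y, ∃ V ∈ 𝓝 y, V ⊆ U ∧ IsPreconnected (V \ {y})

theorem not_isEndPoint_real (x : ℝ) : ¬ IsEndPoint x := by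
  intro h
  obtain ⟨V, hV, -, hc⟩ := h univ Filter.univ_mem
  obtain ⟨ε, hε, hb⟩ := Metric.mem_nhds_iff.1 hV
  have hm : ∀ s : ℝ, |s| < ε → s ≠ 0 → x + s ∈ V \ {x} := fun s hs h0 =>
    ⟨hb (by simpa [Real.dist_eq] using hs), by simpa using h0⟩
  have h1 := hm (-(ε / 2)) (by rw [abs_neg, abs_of_pos] <;> linarith) (by linarith)
  have h2 := hm (ε / 2) (by rw [abs_of_pos] <;> linarith) (by linarith)
  exact (hc.Icc_subset h1 h2 ⟨by linarith, by linarith⟩).2 rfl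

theorem IsEndPoint.subtype {Y : Type*} [TopologicalSpace Y] {s : Set Y} (hs : IsOpen s) (y : s)
    (h : IsEndPoint (y : Y)) : IsEndPoint y := by
  intro U hU
  obtain ⟨V, hV, hVU, hc⟩ := h _ (hs.isOpenEmbedding_subtypeVal.image_mem_nhds.2 hU)
  refine ⟨Subtype.val ⁻¹' V, continuous_subtype_val.continuousAt hV, ?_, ?_⟩
  · intro z hz
    obtain ⟨w, hw, hwz⟩ := hVU hz
    rwa [← Subtype.val_injective hwz]
  · rw [← IsInducing.subtypeVal.isPreconnected_image]
    convert hc using 1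
    ext z
    constructor
    · rintro ⟨w, ⟨hw, hwy⟩, rfl⟩
      exact ⟨hw, fun h => hwy (Subtype.val_injective h)⟩
    · rintro ⟨hz, hzy⟩
      obtain ⟨w, hw, rfl⟩ := hVU hz
      exact ⟨w, ⟨hz, fun h => hzy (by rw [h]; rfl)⟩, rfl⟩

theorem IsEndPoint.of_homeomorph {Y W : Type*} [TopologicalSpace Y] [TopologicalSpace W]
    (φ : Y ≃ₜ W) {y : Y} (h : IsEndPoint y) : IsEndPoint (φ y) := by
  intro U hU
  obtain ⟨V, hV, hVU, hc⟩ := h _ (φ.continuous.continuousAt hU)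
  refine ⟨φ '' V, φ.isOpenEmbedding.image_mem_nhds.2 hV, image_subset_iff.2 hVU, ?_⟩
  rw [← image_singleton, ← image_sdiff φ.injective]
  exact hc.image _ φ.continuous.continuousOn

/-- An edge is open and homeomorphic to ℝ, which has no endpoint. -/
theorem EGraph.mem_vertices_of_isEndPoint {Y : Type*} [TopologicalSpace Y] (Γ : EGraph Y) {y : Y}
    (h : IsEndPoint y) : y ∈ Γ.vertices := by
  rcases (Γ.cover ▸ mem_univ y : y ∈ Γ.vertices ∪ ⋃₀ Γ.edges) with hv | ⟨a, ha, hy⟩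
  · exact hv
  · obtain ⟨ψ⟩ := Γ.edge_homeo a ha
    exact absurd ((IsEndPoint.subtype (Γ.isOpen_edge ha) ⟨y, hy⟩ h).of_homeomorph ψ)
      (not_isEndPoint_real _)

/-- The endpoints of a space which is homeomorphic to an E-graph do not accumulate. -/
theorem HomeomorphicToEGraph.finite_endPoints {Y : Type*} [TopologicalSpace Y]
    (h : HomeomorphicToEGraph.{u} Y) (y : Y) : ∃ U ∈ 𝓝 y, ({x | IsEndPoint x} ∩ U).Finite := by
  obtain ⟨W, _, ⟨Γ⟩, ⟨φ⟩⟩ := h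
  obtain ⟨U, hU, hv, -⟩ := (Γ.comap φ).locally_finite y
  exact ⟨U, hU, hv.subset (inter_subset_inter_left _ fun x hx =>
    (Γ.comap φ).mem_vertices_of_isEndPoint hx)⟩

/-! ### The comb as a Peano continuum. -/

/-- A strictly decreasing sequence of positive numbers which tends to `0`. -/
structure IsCombSeq (H : ℕ → ℝ) : Prop where
  anti : StrictAnti H
  pos : ∀ k, 0 < H k
  lim : Filter.Tendsto H Filter.atTop (𝓝 0)

/-- A diagonal spine from `(0, 0)` to `(H 0, H 0)` together with horizontal teeth which join the
points `(0, H k)`, `1 ≤ k`, to the spine. -/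
def combSet (H : ℕ → ℝ) : Set (ℝ × ℝ) :=
  {x | 0 ≤ x.1 ∧ x.1 ≤ x.2 ∧ x.2 ≤ H 0 ∧ (x.1 = x.2 ∨ ∃ k, x.2 = H (k + 1))}

namespace IsCombSeq

variable {H : ℕ → ℝ} (hH : IsCombSeq H)

include hH

theorem tooth_mem (k : ℕ) {t : ℝ} (h0 : 0 ≤ t) (ht : t ≤ H (k + 1)) : (t, H (k + 1)) ∈ combSet H :=
  ⟨h0, ht, hH.anti.antitone (Nat.zero_le _), Or.inr ⟨k, rfl⟩⟩

omit hH in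
theorem spine_mem {t : ℝ} (h0 : 0 ≤ t) (ht : t ≤ H 0) : (t, t) ∈ combSet H :=
  ⟨h0, le_rfl, ht, Or.inl rfl⟩

theorem isCompact_combSet : IsCompact (combSet H) := by
  -- Adjoining the limit makes the set of tooth heights closed. It adds no point to the comb: height
  -- 0 forces the origin, which is on the spine.
  have h1 : IsClosed (insert 0 (range fun k => H (k + 1))) :=
    ((hH.lim.comp (Filter.tendsto_add_atTop_nat 1)).isCompact_insert_range).isClosed
  have h2 : combSet H = (Icc 0 (H 0) ×ˢ Icc 0 (H 0) ∩ {x | x.1 ≤ x.2}) ∩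
      ({x | x.1 = x.2} ∪ Prod.snd ⁻¹' (insert 0 (range fun k => H (k + 1)))) := by
    ext ⟨t, u⟩
    simp only [combSet, mem_ofPred_eq, mem_inter_iff, mem_prod, mem_Icc, mem_union, mem_preimage,
      mem_insert_iff, mem_range]
    constructor
    · rintro ⟨h0, h1, h2, h3 | ⟨k, h3⟩⟩
      · exact ⟨⟨⟨⟨h0, h1.trans h2⟩, h0.trans h1, h2⟩, h1⟩, Or.inl h3⟩
      · exact ⟨⟨⟨⟨h0, h1.trans h2⟩, h0.trans h1, h2⟩, h1⟩, Or.inr (Or.inr ⟨k, h3.symm⟩)⟩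
    · rintro ⟨⟨⟨⟨h0, -⟩, -, h2⟩, h1⟩, h3 | h3 | ⟨k, h3⟩⟩
      · exact ⟨h0, h1, h2, Or.inl h3⟩
      · exact ⟨h0, h1, h2, Or.inl (by linarith)⟩
      · exact ⟨h0, h1, h2, Or.inr ⟨k, h3.symm⟩⟩
  rw [h2]
  refine ((isCompact_Icc.prod isCompact_Icc).inter_right
    (isClosed_le continuous_fst continuous_snd)).inter_right ?_
  exact (isClosed_eq continuous_fst continuous_snd).union (h1.preimage continuous_snd)

-- The join runs right along the tooth of x to the spine, up the spine, and left along the tooth of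
-- y. The bounds keep it inside any section given by a lower bound on the abscissa and bounds on the
-- ordinate.
omit hH in
theorem exists_join_of_le {x y : ℝ × ℝ} (hx : x ∈ combSet H) (hy : y ∈ combSet H)
    (hxy : x.2 ≤ y.2) : ∃ C ⊆ combSet H, IsPreconnected C ∧ x ∈ C ∧ y ∈ C ∧
      ∀ z ∈ C, min x.1 y.1 ≤ z.1 ∧ x.2 ≤ z.2 ∧ z.2 ≤ y.2 := by
  have hseg : ∀ x ∈ combSet H, ∀ t ∈ Icc x.1 x.2, (t, x.2) ∈ combSet H := by
    rintro x ⟨h0, h1, h2, h3⟩ t ⟨ht1, ht2⟩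
    refine ⟨h0.trans ht1, ht2, h2, ?_⟩
    rcases h3 with h3 | h3
    · exact Or.inl (le_antisymm ht2 (h3 ▸ ht1))
    · exact Or.inr h3
  have hpre : ∀ x ∈ combSet H, IsPreconnected ((fun t : ℝ => (t, x.2)) '' Icc x.1 x.2) :=
    fun x hx => isPreconnected_Icc.image _ (by fun_prop)
  refine ⟨(fun t : ℝ => (t, x.2)) '' Icc x.1 x.2 ∪ ((fun t : ℝ => (t, t)) '' Icc x.2 y.2 ∪
    (fun t : ℝ => (t, y.2)) '' Icc y.1 y.2), ?_, ?_, ?_, ?_, ?_⟩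
  · rintro z (⟨t, ht, rfl⟩ | ⟨t, ht, rfl⟩ | ⟨t, ht, rfl⟩)
    · exact hseg x hx t ht
    · exact spine_mem ((hx.1.trans hx.2.1).trans ht.1) (ht.2.trans hy.2.2.1)
    · exact hseg y hy t ht
  · refine IsPreconnected.union (x.2, x.2) ⟨x.2, ⟨hx.2.1, le_rfl⟩, rfl⟩
      (Or.inl ⟨x.2, ⟨le_rfl, hxy⟩, rfl⟩) (hpre x hx) ?_
    exact IsPreconnected.union (y.2, y.2) ⟨y.2, ⟨hxy, le_rfl⟩, rfl⟩
      ⟨y.2, ⟨hy.2.1, le_rfl⟩, rfl⟩ (isPreconnected_Icc.image _ (by fun_prop)) (hpre y hy)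
  · exact Or.inl ⟨x.1, ⟨le_rfl, hx.2.1⟩, rfl⟩
  · exact Or.inr (Or.inr ⟨y.1, ⟨le_rfl, hy.2.1⟩, rfl⟩)
  · rintro z (⟨t, ht, rfl⟩ | ⟨t, ht, rfl⟩ | ⟨t, ht, rfl⟩)
    · exact ⟨(min_le_left _ _).trans ht.1, le_rfl, hxy⟩
    · exact ⟨(min_le_left _ _).trans (hx.2.1.trans ht.1), ht.1, ht.2⟩
    · exact ⟨(min_le_right _ _).trans ht.1, hxy, le_rfl⟩

omit hH in
theorem isPreconnected_section {s a b : ℝ} :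
    IsPreconnected {x ∈ combSet H | s < x.1 ∧ a < x.2 ∧ x.2 < b} := by
  refine isPreconnected_of_forall_pair fun x hx y hy => ?_
  rcases le_total x.2 y.2 with h | h
  · obtain ⟨C, hC, hc, hxC, hyC, h1⟩ := exists_join_of_le hx.1 hy.1 h
    refine ⟨C, fun z hz => ⟨hC hz, (lt_min hx.2.1 hy.2.1).trans_le (h1 z hz).1, ?_, ?_⟩,
      hxC, hyC, hc⟩
    · exact hx.2.2.1.trans_le (h1 z hz).2.1
    · exact (h1 z hz).2.2.trans_lt hy.2.2.2
  · obtain ⟨C, hC, hc, hyC, hxC, h1⟩ := exists_join_of_le hy.1 hx.1 h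
    refine ⟨C, fun z hz => ⟨hC hz, (lt_min hy.2.1 hx.2.1).trans_le (h1 z hz).1, ?_, ?_⟩,
      hxC, hyC, hc⟩
    · exact hy.2.2.1.trans_le (h1 z hz).2.1
    · exact (h1 z hz).2.2.trans_lt hx.2.2.2

/-- The strip between the heights H (k + 2) and H k thus isolates a single tooth. -/
theorem eq_of_mem_Ioo {k j : ℕ} (h1 : H (k + 2) < H (j + 1)) (h2 : H (j + 1) < H k) : j = k := by
  have h3 := hH.anti.lt_iff_gt.1 h1
  have h4 := hH.anti.lt_iff_gt.1 h2
  omega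

theorem isPreconnected_tooth (k : ℕ) (s : Set ℝ) [s.OrdConnected] :
    IsPreconnected {x ∈ combSet H | x.1 < x.2 ∧ H (k + 2) < x.2 ∧ x.2 < H k ∧ x.1 ∈ s} := by
  have h : {x ∈ combSet H | x.1 < x.2 ∧ H (k + 2) < x.2 ∧ x.2 < H k ∧ x.1 ∈ s} =
      (fun t : ℝ => (t, H (k + 1))) '' (Ico 0 (H (k + 1)) ∩ s) := by
    ext ⟨t, u⟩
    constructor
    · rintro ⟨⟨h0, h1, h2, h3⟩, h4, h5, h6, h7⟩
      rcases h3 with h3 | ⟨j, h3⟩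
      · exact absurd h3 h4.ne
      · simp only at h0 h3 h4 h5 h6 h7
        subst h3
        obtain rfl := hH.eq_of_mem_Ioo h5 h6
        exact ⟨t, ⟨⟨h0, h4⟩, h7⟩, rfl⟩
    · rintro ⟨t, ⟨⟨h0, h1⟩, h2⟩, h⟩
      rw [← h]
      exact ⟨hH.tooth_mem k h0 h1.le, h1, hH.anti (by omega), hH.anti (by omega), h2⟩
  rw [h]
  exact ((ordConnected_Ico.inter inferInstance).isPreconnected).image _ (by fun_prop)

/-- At a point of the spine, the tip included, a section is small because the abscissa never exceeds
the ordinate. Off the spine a strip leaves only an interval of one tooth. -/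
theorem locallyConnectedSpace : LocallyConnectedSpace (combSet H) := by
  rw [locallyConnectedSpace_iff_connected_subsets]
  rintro ⟨⟨t, u⟩, hx⟩ U hU
  obtain ⟨ε, hε, hb⟩ := Metric.mem_nhds_iff.1 hU
  have hpre : ∀ s : Set (ℝ × ℝ), IsPreconnected {x ∈ combSet H | x ∈ s} →
      IsPreconnected (Subtype.val ⁻¹' s : Set (combSet H)) := fun s hs => by
    rw [← IsInducing.subtypeVal.isPreconnected_image, Subtype.image_preimage_coe]
    exact hs
  by_cases htu : t = u
  · subst htu
    refine ⟨Subtype.val ⁻¹' {x | t - ε < x.1 ∧ t - ε < x.2 ∧ x.2 < t + ε}, ?_,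
      hpre _ isPreconnected_section, ?_⟩
    · refine IsOpen.mem_nhds ?_ ?_
      · refine IsOpen.preimage continuous_subtype_val ?_
        exact (isOpen_lt continuous_const continuous_fst).inter
          ((isOpen_lt continuous_const continuous_snd).inter
            (isOpen_lt continuous_snd continuous_const))
      · show t - ε < t ∧ t - ε < t ∧ t < t + ε
        exact ⟨by linarith, by linarith, by linarith⟩
    · rintro ⟨⟨a, b⟩, hab⟩ ⟨h1, h2, h3⟩
      apply hb
      have h4 := hab.2.1
      simp only at h1 h2 h3 h4
      rw [Metric.mem_ball, Subtype.dist_eq, Prod.dist_eq, max_lt_iff, Real.dist_eq, Real.dist_eq,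
        abs_lt, abs_lt]
      exact ⟨⟨by linarith, by linarith⟩, by linarith, by linarith⟩
  · obtain ⟨h0, h1, h2, h3 | ⟨k, h3⟩⟩ := hx
    · exact absurd h3 htu
    simp only at h0 h1 h2 h3
    subst h3
    have h1' : t < H (k + 1) := lt_of_le_of_ne h1 htu
    refine ⟨Subtype.val ⁻¹' {x | x.1 < x.2 ∧ H (k + 2) < x.2 ∧ x.2 < H k ∧
      x.1 ∈ Ioo (t - ε) (t + ε)}, ?_, hpre _ (hH.isPreconnected_tooth k _), ?_⟩
    · refine IsOpen.mem_nhds ?_ ?_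
      · refine IsOpen.preimage continuous_subtype_val ?_
        exact (isOpen_lt continuous_fst continuous_snd).inter
          ((isOpen_lt continuous_const continuous_snd).inter
            ((isOpen_lt continuous_snd continuous_const).inter
              (isOpen_Ioo.preimage continuous_fst)))
      · show t < H (k + 1) ∧ H (k + 2) < H (k + 1) ∧ H (k + 1) < H k ∧ t - ε < t ∧ t < t + ε
        exact ⟨h1', hH.anti (by omega), hH.anti (by omega), by linarith, by linarith⟩
    · rintro ⟨⟨a, b⟩, hab⟩ ⟨h4, h5, h6, h7, h8⟩
      apply hb
      obtain ⟨-, -, -, h9 | ⟨j, h9⟩⟩ := id hab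
      · exact absurd h9 h4.ne
      simp only at h4 h5 h6 h7 h8 h9
      subst h9
      obtain rfl := hH.eq_of_mem_Ioo h5 h6
      rw [Metric.mem_ball, Subtype.dist_eq, Prod.dist_eq, max_lt_iff, Real.dist_eq, Real.dist_eq,
        abs_lt, abs_lt]
      exact ⟨⟨by linarith, by linarith⟩, by linarith, by linarith⟩

theorem isConnected_combSet : IsConnected (combSet H) := by
  refine ⟨⟨(0, 0), spine_mem le_rfl (hH.pos 0).le⟩, ?_⟩
  have h := isPreconnected_section (H := H) (s := -1) (a := -1) (b := H 0 + 1)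
  convert h using 1
  ext x
  exact ⟨fun hx => ⟨hx, by linarith [hx.1], by linarith [hx.1, hx.2.1], by linarith [hx.2.2.1]⟩,
    fun hx => hx.1⟩

theorem isPeanoContinuum : IsPeanoContinuum (combSet H) where
  separable := inferInstance
  compact := isCompact_iff_compactSpace.1 hH.isCompact_combSet
  connected := isConnected_iff_connectedSpace.1 hH.isConnected_combSet
  locallyConnected := hH.locallyConnectedSpace
  metrizable := inferInstance

/-- Near its free end a tooth is a half-open interval, and without the end it is an open one. -/
theorem isEndPoint (k : ℕ) :
    IsEndPoint (⟨(0, H (k + 1)), hH.tooth_mem k le_rfl (hH.pos _).le⟩ : combSet H) := by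
  intro U hU
  obtain ⟨ε, hε, hb⟩ := Metric.mem_nhds_iff.1 hU
  refine ⟨Subtype.val ⁻¹' {x | x.1 < x.2 ∧ H (k + 2) < x.2 ∧ x.2 < H k ∧
      x.1 ∈ Iio ε}, ?_, ?_, ?_⟩
  · refine IsOpen.mem_nhds ?_ ?_
    · refine IsOpen.preimage continuous_subtype_val ?_
      exact (isOpen_lt continuous_fst continuous_snd).inter
        ((isOpen_lt continuous_const continuous_snd).inter
          ((isOpen_lt continuous_snd continuous_const).inter
            (isOpen_Iio.preimage continuous_fst)))
    · show 0 < H (k + 1) ∧ H (k + 2) < H (k + 1) ∧ H (k + 1) < H k ∧ 0 < ε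
      exact ⟨hH.pos _, hH.anti (by omega), hH.anti (by omega), hε⟩
  · rintro ⟨⟨a, b⟩, hab⟩ ⟨h4, h5, h6, h7⟩
    apply hb
    obtain ⟨h8, -, -, h9 | ⟨j, h9⟩⟩ := id hab
    · exact absurd h9 h4.ne
    simp only [mem_Iio] at h4 h5 h6 h7 h8 h9
    subst h9
    obtain rfl := hH.eq_of_mem_Ioo h5 h6
    rw [Metric.mem_ball, Subtype.dist_eq, Prod.dist_eq, max_lt_iff, Real.dist_eq, Real.dist_eq,
      abs_lt, abs_lt]
    exact ⟨⟨by linarith, by linarith⟩, by linarith, by linarith⟩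
  · rw [← IsInducing.subtypeVal.isPreconnected_image]
    convert hH.isPreconnected_tooth k (Ioo 0 ε) using 1
    ext ⟨a, b⟩
    constructor
    · rintro ⟨⟨⟨a', b'⟩, hab⟩, ⟨⟨h4, h5, h6, h7⟩, h8⟩, h⟩
      obtain ⟨rfl, rfl⟩ := Prod.mk.inj h
      refine ⟨hab, h4, h5, h6, lt_of_le_of_ne hab.1 ?_, h7⟩
      rintro h0
      simp only at h0 h4 h5 h6
      subst h0
      obtain ⟨-, -, -, h9 | ⟨j, h9⟩⟩ := id hab
      · exact absurd h9 h4.ne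
      simp only at h9
      subst h9
      obtain rfl := hH.eq_of_mem_Ioo h5 h6
      exact h8 rfl
    · rintro ⟨hab, h4, h5, h6, h7, h8⟩
      refine ⟨⟨(a, b), hab⟩, ⟨⟨h4, h5, h6, h8⟩, ?_⟩, rfl⟩
      intro h
      exact h7.ne' (congrArg (fun x : combSet H => x.1.1) h)

end IsCombSeq

/-! ### The E-graph structure on the comb without its tip. -/

namespace IsCombSeq

variable {H : ℕ → ℝ} (hH : IsCombSeq H)

/-- The point of accumulation of the teeth of a comb. -/
def tip (hH : IsCombSeq H) : combSet H := ⟨(0, 0), spine_mem le_rfl (hH.pos 0).le⟩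

include hH

theorem ne_tip_iff (x : combSet H) : x ≠ hH.tip ↔ 0 < x.1.2 := by
  obtain ⟨⟨t, u⟩, h0, h1, h2, h3⟩ := x
  simp only at h0 h1 ⊢
  constructor
  · intro h
    refine lt_of_le_of_ne (h0.trans h1) ?_
    rintro rfl
    obtain rfl := le_antisymm h0 h1
    exact h rfl
  · intro h heq
    exact h.ne' (congrArg (fun x : combSet H => x.1.2) heq)

/-- The part of a comb without its tip which is the graph over `A` of a function `f`. -/
def graphSet (A : Set ℝ) (f : ℝ → ℝ) : Set {x : combSet H // x ≠ hH.tip} :=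
  {y | y.1.1.1 ∈ A ∧ y.1.1.2 = f y.1.1.1}

/-- The point of a comb over `t` on the graph of `f`. -/
def graphPoint {A : Set ℝ} {f : ℝ → ℝ}
    (hA : ∀ t ∈ A, (t, f t) ∈ combSet H ∧ 0 < f t) (t : A) : {x : combSet H // x ≠ hH.tip} :=
  ⟨⟨(t, f t), (hA t t.2).1⟩, (hH.ne_tip_iff _).2 (hA t t.2).2⟩

/-- A graph over `A` is homeomorphic to `A`. -/
def graphHomeo {A : Set ℝ} {f : ℝ → ℝ} (hf : Continuous f)
    (hA : ∀ t ∈ A, (t, f t) ∈ combSet H ∧ 0 < f t) : hH.graphSet A f ≃ₜ A where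
  toFun y := ⟨y.1.1.1.1, y.2.1⟩
  invFun t := ⟨hH.graphPoint hA t, t.2, rfl⟩
  left_inv := by
    rintro ⟨⟨⟨⟨t, u⟩, h1⟩, h2⟩, h3, h4⟩
    simp only at h3 h4
    subst h4
    rfl
  right_inv t := rfl
  continuous_toFun := by fun_prop
  continuous_invFun := by
    unfold graphPoint
    fun_prop

/-- The graph over the closed interval is closed, and its continuous parametrization turns density
of `Ioo a b` in `Icc a b` into density of the open graph. -/
theorem closure_graphSet {a b : ℝ} (hab : a < b) {f : ℝ → ℝ} (hf : Continuous f)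
    (hA : ∀ t ∈ Icc a b, (t, f t) ∈ combSet H ∧ 0 < f t) :
    closure (hH.graphSet (Ioo a b) f) = hH.graphSet (Icc a b) f := by
  apply Subset.antisymm
  · refine closure_minimal (fun y hy => ⟨Ioo_subset_Icc_self hy.1, hy.2⟩) ?_
    refine IsClosed.inter (isClosed_Icc.preimage (by fun_prop)) ?_
    exact isClosed_eq (by fun_prop) (by fun_prop)
  · intro y hy
    have hc : Continuous (hH.graphPoint hA) := by
      unfold graphPoint
      fun_prop
    have hd : (⟨y.1.1.1, hy.1⟩ : Icc a b) ∈ closure (Subtype.val ⁻¹' Ioo a b) := by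
      rw [closure_subtype, Subtype.image_preimage_coe, inter_eq_right.2 Ioo_subset_Icc_self,
        closure_Ioo hab.ne]
      exact hy.1
    have h := image_closure_subset_closure_image hc (mem_image_of_mem _ hd)
    have hy' : hH.graphPoint hA ⟨y.1.1.1, hy.1⟩ = y :=
      congrArg Subtype.val ((hH.graphHomeo hf hA).symm_apply_apply ⟨y, hy⟩)
    rw [hy'] at h
    refine closure_mono ?_ h
    rintro _ ⟨t, ht, rfl⟩
    exact ⟨ht, rfl⟩

omit hH in
theorem nonempty_Ioo_homeomorph {a b : ℝ} (hab : a < b) : Nonempty (Ioo a b ≃ₜ ℝ) := by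
  have h : (fun x => (b - a) / Real.pi * x + (a + b) / 2) ''
      Ioo (-(Real.pi / 2)) (Real.pi / 2) = Ioo a b := by
    have hpi := Real.pi_pos
    rw [Set.image_affine_Ioo (by have := sub_pos.2 hab; positivity)]
    congr 1 <;> field_simp <;> ring
  have hne : (b - a) / Real.pi ≠ 0 := by
    have := sub_pos.2 hab
    have := Real.pi_pos
    positivity
  exact ⟨((Homeomorph.setCongr h.symm).trans
    ((affineHomeomorph ((b - a) / Real.pi) ((a + b) / 2) hne).image _).symm).trans
    Real.tanOrderIso.toHomeomorph⟩

omit hH in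
theorem nonempty_Icc_homeomorph {a b : ℝ} (hab : a < b) :
    Nonempty (Icc a b ≃ₜ Icc (-1 : ℝ) 1) :=
  ⟨(iccHomeoI a b hab).trans (iccHomeoI (-1) 1 (by norm_num)).symm⟩

theorem spine_graph (k : ℕ) : ∀ t ∈ Icc (H (k + 1)) (H k), (t, id t) ∈ combSet H ∧ 0 < id t :=
  fun _ ht => ⟨spine_mem ((hH.pos _).le.trans ht.1) (ht.2.trans (hH.anti.antitone (Nat.zero_le _))),
    (hH.pos _).trans_le ht.1⟩

theorem tooth_graph (k : ℕ) : ∀ t ∈ Icc 0 (H (k + 1)), (t, Function.const ℝ (H (k + 1)) t) ∈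
    combSet H ∧ 0 < Function.const ℝ (H (k + 1)) t :=
  fun _ ht => ⟨hH.tooth_mem k ht.1 ht.2, hH.pos _⟩

/-- The vertices of a comb without its tip. -/
def vertexSet : Set {x : combSet H // x ≠ hH.tip} :=
  {y | (∃ k, y.1.1 = (H k, H k)) ∨ ∃ k, y.1.1 = (0, H (k + 1))}

/-- The edges on the spine of a comb. -/
def spineEdge (k : ℕ) : Set {x : combSet H // x ≠ hH.tip} :=
  hH.graphSet (Ioo (H (k + 1)) (H k)) id

/-- The teeth of a comb, as edges. -/
def toothEdge (k : ℕ) : Set {x : combSet H // x ≠ hH.tip} :=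
  hH.graphSet (Ioo 0 (H (k + 1))) (Function.const ℝ (H (k + 1)))

theorem closure_spineEdge (k : ℕ) :
    closure (hH.spineEdge k) = hH.graphSet (Icc (H (k + 1)) (H k)) id :=
  hH.closure_graphSet (hH.anti (by omega)) continuous_id (hH.spine_graph k)

theorem closure_toothEdge (k : ℕ) : closure (hH.toothEdge k) =
    hH.graphSet (Icc 0 (H (k + 1))) (Function.const ℝ (H (k + 1))) :=
  hH.closure_graphSet (hH.pos _) continuous_const (hH.tooth_graph k)

theorem eq_of_mem_gaps {j k : ℕ} {t : ℝ} (h : t ∈ Ioo (H (j + 1)) (H j))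
    (h' : t ∈ Ioo (H (k + 1)) (H k)) : j = k := by
  have h1 := hH.anti.lt_iff_gt.1 (h.1.trans h'.2)
  have h2 := hH.anti.lt_iff_gt.1 (h'.1.trans h.2)
  omega

theorem not_mem_gap {j k : ℕ} (h : H j ∈ Ioo (H (k + 1)) (H k)) : False := by
  have h1 := hH.anti.lt_iff_gt.1 h.1
  have h2 := hH.anti.lt_iff_gt.1 h.2
  omega

theorem disjoint_vertexSet_spineEdge (k : ℕ) : Disjoint (hH.spineEdge k) hH.vertexSet := by
  rw [Set.disjoint_left]
  rintro ⟨⟨⟨t, u⟩, hx⟩, hne⟩ ⟨h1, h2⟩ (⟨j, h3⟩ | ⟨j, h3⟩)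
  · obtain ⟨rfl, rfl⟩ := Prod.mk.inj h3
    exact hH.not_mem_gap h1
  · obtain ⟨rfl, rfl⟩ := Prod.mk.inj h3
    exact (hH.pos (j + 1)).ne' h2

theorem disjoint_vertexSet_toothEdge (k : ℕ) : Disjoint (hH.toothEdge k) hH.vertexSet := by
  rw [Set.disjoint_left]
  rintro ⟨⟨⟨t, u⟩, hx⟩, hne⟩ ⟨h1, h2⟩ (⟨j, h3⟩ | ⟨j, h3⟩)
  · obtain ⟨rfl, rfl⟩ := Prod.mk.inj h3
    simp only [Function.const_apply] at h2
    exact h1.2.ne h2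
  · obtain ⟨rfl, rfl⟩ := Prod.mk.inj h3
    exact h1.1.ne rfl

theorem disjoint_spineEdge_toothEdge (j k : ℕ) : Disjoint (hH.spineEdge j) (hH.toothEdge k) := by
  rw [Set.disjoint_left]
  rintro ⟨⟨⟨t, u⟩, hx⟩, hne⟩ ⟨h1, h2⟩ ⟨h3, h4⟩
  simp only [Function.const_apply, id] at h2 h3 h4
  exact h3.2.ne (h2.symm.trans h4)

theorem mem_vertexSet_or (y : {x : combSet H // x ≠ hH.tip}) : y ∈ hH.vertexSet ∨
    (∃ k, y ∈ hH.spineEdge k) ∨ ∃ k, y ∈ hH.toothEdge k := by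
  have hy := (hH.ne_tip_iff _).1 y.2
  obtain ⟨⟨⟨t, u⟩, hx⟩, hne⟩ := y
  obtain ⟨h0, h1, h2, h3⟩ := id hx
  simp only at hy h0 h1 h2 h3
  by_cases htu : t = u
  · subst htu
    have hex : ∃ n, H n ≤ t := ((hH.lim.eventually (gt_mem_nhds hy)).exists).imp fun n hn => hn.le
    classical
    rcases hn : Nat.find hex with _ | n
    · have h := Nat.find_spec hex
      rw [hn] at h
      exact Or.inl (Or.inl ⟨0, Prod.ext (le_antisymm h2 h) (le_antisymm h2 h)⟩)
    · have h := Nat.find_spec hex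
      have h' := Nat.find_min hex (m := n) (by omega)
      rw [hn] at h
      rcases h.eq_or_lt with h | h
      · exact Or.inl (Or.inl ⟨n + 1, by rw [h]⟩)
      · exact Or.inr (Or.inl ⟨n, ⟨h, not_le.1 h'⟩, rfl⟩)
  · rcases h3 with h3 | ⟨k, rfl⟩
    · exact absurd h3 htu
    · rcases h0.eq_or_lt with rfl | h0
      · exact Or.inl (Or.inr ⟨k, rfl⟩)
      · exact Or.inr (Or.inr ⟨k, ⟨h0, lt_of_le_of_ne h1 htu⟩, rfl⟩)

theorem finite_setOf_lt {c : ℝ} (hc : 0 < c) : {k | c < H k}.Finite := by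
  obtain ⟨N, hN⟩ := Filter.eventually_atTop.1 (hH.lim.eventually (gt_mem_nhds hc))
  refine (finite_lt_nat N).subset fun k hk => ?_
  by_contra h
  exact lt_asymm hk (hN k (not_lt.1 h))

/-- The E-graph structure on a comb without its tip. -/
def eGraph : EGraph {x : combSet H // x ≠ hH.tip} where
  vertices := hH.vertexSet
  edges := range hH.spineEdge ∪ range hH.toothEdge
  t2 := inferInstance
  disjoint_vertices := by
    rintro _ (⟨k, rfl⟩ | ⟨k, rfl⟩)
    · exact hH.disjoint_vertexSet_spineEdge k
    · exact hH.disjoint_vertexSet_toothEdge k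
  disjoint_edges := by
    rintro _ (⟨j, rfl⟩ | ⟨j, rfl⟩) _ (⟨k, rfl⟩ | ⟨k, rfl⟩) hne
    · rw [Function.onFun, id, id, Set.disjoint_left]
      intro y h h'
      exact hne (congrArg _ (hH.eq_of_mem_gaps h.1 h'.1))
    · exact hH.disjoint_spineEdge_toothEdge j k
    · exact (hH.disjoint_spineEdge_toothEdge k j).symm
    · rw [Function.onFun, id, id, Set.disjoint_left]
      intro y h h'
      have h1 : H (j + 1) = H (k + 1) := h.2.symm.trans h'.2
      have h2 := hH.anti.injective h1
      exact hne (congrArg _ (by omega))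
  cover := by
    refine eq_univ_of_forall fun y => ?_
    rcases hH.mem_vertexSet_or y with h | ⟨k, h⟩ | ⟨k, h⟩
    · exact Or.inl h
    · exact Or.inr ⟨_, Or.inl ⟨k, rfl⟩, h⟩
    · exact Or.inr ⟨_, Or.inr ⟨k, rfl⟩, h⟩
  edge_homeo := by
    rintro _ (⟨k, rfl⟩ | ⟨k, rfl⟩)
    · obtain ⟨φ⟩ := nonempty_Ioo_homeomorph (hH.anti (Nat.lt_succ_self k))
      exact ⟨(hH.graphHomeo continuous_id
        fun t ht => hH.spine_graph k t (Ioo_subset_Icc_self ht)).trans φ⟩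
    · obtain ⟨φ⟩ := nonempty_Ioo_homeomorph (hH.pos (k + 1))
      exact ⟨(hH.graphHomeo continuous_const
        fun t ht => hH.tooth_graph k t (Ioo_subset_Icc_self ht)).trans φ⟩
  closure_diff_subset := by
    rintro _ (⟨k, rfl⟩ | ⟨k, rfl⟩)
    · rw [hH.closure_spineEdge]
      rintro ⟨⟨⟨t, u⟩, hx⟩, hne⟩ ⟨⟨⟨h1, h2⟩, h3⟩, h4⟩
      simp only [id] at h1 h2 h3
      subst h3
      rcases h1.eq_or_lt with h1 | h1
      · exact Or.inl ⟨k + 1, by rw [h1]⟩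
      rcases h2.eq_or_lt with h2 | h2
      · exact Or.inl ⟨k, Prod.ext h2 h2⟩
      exact absurd ⟨⟨h1, h2⟩, rfl⟩ h4
    · rw [hH.closure_toothEdge]
      rintro ⟨⟨⟨t, u⟩, hx⟩, hne⟩ ⟨⟨⟨h1, h2⟩, h3⟩, h4⟩
      simp only [Function.const_apply] at h1 h2 h3
      subst h3
      rcases h1.eq_or_lt with h1 | h1
      · exact Or.inr ⟨k, by rw [h1]⟩
      rcases h2.eq_or_lt with h2 | h2
      · exact Or.inl ⟨k + 1, Prod.ext h2 rfl⟩
      exact absurd ⟨⟨h1, h2⟩, rfl⟩ h4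
  closure_homeo := by
    rintro _ (⟨k, rfl⟩ | ⟨k, rfl⟩)
    · obtain ⟨φ⟩ := nonempty_Icc_homeomorph (hH.anti (Nat.lt_succ_self k))
      rw [hH.closure_spineEdge]
      exact Or.inl ⟨(hH.graphHomeo continuous_id (hH.spine_graph k)).trans φ⟩
    · obtain ⟨φ⟩ := nonempty_Icc_homeomorph (hH.pos (k + 1))
      rw [hH.closure_toothEdge]
      exact Or.inl ⟨(hH.graphHomeo continuous_const (hH.tooth_graph k)).trans φ⟩
  locally_finite := fun y => by
    have hy := (hH.ne_tip_iff _).1 y.2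
    have hfin := hH.finite_setOf_lt (half_pos hy)
    have hfin' : {k | y.1.1.2 / 2 < H (k + 1)}.Finite :=
      Set.Finite.preimage (f := fun k => k + 1) (add_left_injective 1).injOn hfin
    -- The heights tend to 0, so only finitely many vertices and edges reach above half the ordinate
    -- of y.
    refine ⟨{x | y.1.1.2 / 2 < x.1.1.2}, ?_, ?_, ?_⟩
    · refine IsOpen.mem_nhds (isOpen_lt continuous_const (by fun_prop)) ?_
      show y.1.1.2 / 2 < y.1.1.2
      linarith
    · refine Set.Finite.of_finite_image (f := fun x => x.1.1) ?_
        (Subtype.val_injective.comp Subtype.val_injective).injOn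
      refine ((hfin.image fun k => (H k, H k)).union
        (hfin'.image fun k => ((0 : ℝ), H (k + 1)))).subset ?_
      rintro _ ⟨x, ⟨⟨k, hk⟩ | ⟨k, hk⟩, hxU⟩, rfl⟩
      · have hxU' : y.1.1.2 / 2 < x.1.1.2 := hxU
        rw [hk] at hxU'
        exact Or.inl ⟨k, hxU', hk.symm⟩
      · have hxU' : y.1.1.2 / 2 < x.1.1.2 := hxU
        rw [hk] at hxU'
        exact Or.inr ⟨k, hxU', hk.symm⟩
    · refine ((hfin.image hH.spineEdge).union (hfin'.image hH.toothEdge)).subset ?_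
      rintro _ ⟨⟨k, rfl⟩ | ⟨k, rfl⟩, x, hx, hxU⟩
      · have hxU' : y.1.1.2 / 2 < x.1.1.2 := hxU
        rw [hH.closure_spineEdge] at hx
        have h1 : x.1.1.2 = x.1.1.1 := hx.2
        exact Or.inl ⟨k, (hxU'.trans_le (h1.le.trans hx.1.2) : y.1.1.2 / 2 < H k), rfl⟩
      · have hxU' : y.1.1.2 / 2 < x.1.1.2 := hxU
        rw [hH.closure_toothEdge] at hx
        have h1 : x.1.1.2 = H (k + 1) := hx.2
        exact Or.inr ⟨k, (hxU'.trans_eq h1 : y.1.1.2 / 2 < H (k + 1)), rfl⟩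

/-! ### The tip as the only obstruction, and the one-point compactification. -/

/-- The end of the tooth number `k`. -/
def toothEnd (k : ℕ) : combSet H :=
  ⟨(0, H (k + 1)), hH.tooth_mem k le_rfl (hH.pos _).le⟩

theorem toothEnd_injective : Function.Injective hH.toothEnd := fun j k h => by
  have h1 := hH.anti.injective (congrArg (fun x : combSet H => x.1.2) h :)
  omega

theorem tendsto_toothEnd : Filter.Tendsto hH.toothEnd Filter.atTop (𝓝 hH.tip) := by
  rw [tendsto_subtype_rng]
  exact tendsto_const_nhds.prodMk_nhds (hH.lim.comp (Filter.tendsto_add_atTop_nat 1))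

theorem not_homeomorphicToEGraph : ¬ HomeomorphicToEGraph.{u} (combSet H) := by
  intro h
  obtain ⟨U, hU, hfin⟩ := h.finite_endPoints hH.tip
  obtain ⟨N, hN⟩ := Filter.eventually_atTop.1 (hH.tendsto_toothEnd hU)
  refine (Set.infinite_of_injective_forall_mem
    (hH.toothEnd_injective.comp (add_left_injective N)) fun k => ?_) hfin
  exact ⟨hH.isEndPoint _, hN _ (Nat.le_add_left _ _)⟩

/-- If a point other than the tip is removed, the tip survives as a limit of tooth ends, and these
remain endpoints because the complement is open. -/
theorem eq_tip_of_homeomorphicToEGraph (p : combSet H)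
    (h : HomeomorphicToEGraph.{u} {x : combSet H // x ≠ p}) : p = hH.tip := by
  by_contra hp
  obtain ⟨U, hU, hfin⟩ := h.finite_endPoints ⟨hH.tip, Ne.symm hp⟩
  have hopen : IsOpen {x : combSet H | x ≠ p} := isOpen_compl_singleton
  have hU' := hopen.isOpenEmbedding_subtypeVal.image_mem_nhds.2 hU
  obtain ⟨N, hN⟩ := Filter.eventually_atTop.1 (hH.tendsto_toothEnd hU')
  refine (Set.infinite_of_injective_forall_mem
    (hH.toothEnd_injective.comp (add_left_injective N)) fun k => ?_) (hfin.image Subtype.val)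
  obtain ⟨y, hy, hyk⟩ := hN (k + N) (Nat.le_add_left _ _)
  refine ⟨y, ⟨?_, hy⟩, hyk⟩
  have hend : IsEndPoint (y : combSet H) := by
    rw [hyk]
    exact hH.isEndPoint _
  exact IsEndPoint.subtype hopen y hend

theorem not_isClosed_compl_tip : ¬ IsClosed {x : combSet H | x ≠ hH.tip} := by
  intro h
  have h1 := h.mem_of_tendsto hH.tendsto_toothEnd (Filter.Eventually.of_forall fun k =>
    (hH.ne_tip_iff _).2 (hH.pos (k + 1)))
  exact h1 rfl

theorem noncompactSpace : NoncompactSpace {x : combSet H // x ≠ hH.tip} := by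
  rw [← not_compactSpace_iff]
  intro h
  exact hH.not_isClosed_compl_tip (isCompact_iff_compactSpace.2 h).isClosed

theorem exists_onePoint_homeomorph : ∃ ψ : OnePoint {x : combSet H // x ≠ hH.tip} ≃ₜ combSet H,
    ψ OnePoint.infty = hH.tip ∧ ∀ x : {x : combSet H // x ≠ hH.tip}, ψ (x : OnePoint _) = x := by
  have := hH.noncompactSpace
  have := isCompact_iff_compactSpace.1 hH.isCompact_combSet
  refine ⟨OnePoint.equivOfIsEmbeddingOfRangeEq hH.tip Subtype.val IsEmbedding.subtypeVal ?_,
    ?_, ?_⟩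
  · rw [Subtype.range_coe_subtype]
    rfl
  · exact OnePoint.equivOfIsEmbeddingOfRangeEq_apply_infty _ _ _ _
  · exact fun x => OnePoint.equivOfIsEmbeddingOfRangeEq_apply_coe _ _ _ _ x

end IsCombSeq

/-! ### Smoothness of `c₀` at its flat point. -/

section Smoothness

open Polynomial

/-- The functions `e^{-s²/2} (P(s) sin s + Q(s) cos s)` of `s = 1/x`, extended by `0`. -/
noncomputable def flatOsc (P Q : ℝ[X]) (x : ℝ) : ℝ :=
  if x = 0 then 0 else
    Real.exp (-(x⁻¹ ^ 2 / 2)) * (P.eval x⁻¹ * Real.sin x⁻¹ + Q.eval x⁻¹ * Real.cos x⁻¹)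

theorem tendsto_exp_mul_eval (P : ℝ[X]) :
    Filter.Tendsto (fun s => Real.exp (-(s ^ 2 / 2)) * P.eval s) (Bornology.cobounded ℝ) (𝓝 0) := by
  induction P using Polynomial.induction_on' with
  | add p q hp hq =>
    refine (by simpa using hp.add hq : Filter.Tendsto _ _ (𝓝 (0 : ℝ))).congr fun s => ?_
    rw [eval_add]
    ring
  | monomial n a =>
    have h := tendsto_rpow_abs_mul_exp_neg_mul_sq_cocompact (a := 1 / 2) (by norm_num) n
    rw [← Metric.cobounded_eq_cocompact] at h
    rw [tendsto_zero_iff_norm_tendsto_zero]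
    refine (by simpa using h.const_mul |a| : Filter.Tendsto _ _ (𝓝 (0 : ℝ))).congr fun s => ?_
    rw [eval_monomial, norm_mul, norm_mul, norm_pow, Real.norm_eq_abs, Real.norm_eq_abs,
      Real.norm_eq_abs, Real.abs_exp]
    rw [show -(s ^ 2 / 2) = -(2⁻¹ * s ^ 2) by ring]
    ring

theorem tendsto_flatOsc (P Q : ℝ[X]) :
    Filter.Tendsto (flatOsc P Q) (𝓝[≠] 0) (𝓝 0) := by
  have hP := ((tendsto_exp_mul_eval P).comp
    (Filter.tendsto_inv₀_nhdsNE_zero (α := ℝ))).norm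
  have hQ := ((tendsto_exp_mul_eval Q).comp
    (Filter.tendsto_inv₀_nhdsNE_zero (α := ℝ))).norm
  have hPQ := hP.add hQ
  rw [norm_zero, add_zero] at hPQ
  refine squeeze_zero_norm' ?_ hPQ
  filter_upwards [self_mem_nhdsWithin] with x hx
  rw [flatOsc, if_neg (show x ≠ 0 from hx), mul_add]
  refine (norm_add_le _ _).trans (add_le_add ?_ ?_)
  · rw [← mul_assoc, norm_mul]
    exact mul_le_of_le_one_right (norm_nonneg _) (Real.abs_sin_le_one _)
  · rw [← mul_assoc, norm_mul]
    exact mul_le_of_le_one_right (norm_nonneg _) (Real.abs_cos_le_one _)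

/-- In the variable s = 1/x the operator d/dx is −s² d/ds, so the class of these functions is closed
under differentiation; smoothness follows by induction on the order. -/
theorem hasDerivAt_flatOsc (P Q : ℝ[X]) (x : ℝ) :
    HasDerivAt (flatOsc P Q) (flatOsc (-X ^ 2 * (derivative P - Q - X * P))
      (-X ^ 2 * (derivative Q + P - X * Q)) x) x := by
  by_cases hx : x = 0
  · subst hx
    rw [hasDerivAt_iff_tendsto_slope]
    have h0 : ∀ P Q, flatOsc P Q 0 = 0 := fun P Q => if_pos rfl
    rw [h0]
    -- The difference quotient at 0 belongs to the same class, with both polynomials multiplied by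
    -- X.
    refine (tendsto_flatOsc (X * P) (X * Q)).congr' ?_
    filter_upwards [self_mem_nhdsWithin] with y hy
    replace hy : y ≠ 0 := hy
    rw [slope_def_field, h0, flatOsc, flatOsc, if_neg hy, if_neg hy, eval_mul, eval_mul, eval_X,
      sub_zero, sub_zero]
    field_simp
  · have hev : flatOsc P Q =ᶠ[𝓝 x] fun x => Real.exp (-(x⁻¹ ^ 2 / 2)) *
        (P.eval x⁻¹ * Real.sin x⁻¹ + Q.eval x⁻¹ * Real.cos x⁻¹) := by
      filter_upwards [isOpen_compl_singleton.mem_nhds hx] with y hy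
      exact if_neg hy
    refine HasDerivAt.congr_of_eventuallyEq ?_ hev
    have hi := hasDerivAt_inv hx
    have h1 := (((hi.fun_pow 2).div_const 2).fun_neg).exp
    have h2 := ((P.hasDerivAt x⁻¹).comp x hi).mul hi.sin
    have h3 := ((Q.hasDerivAt x⁻¹).comp x hi).mul hi.cos
    refine (h1.mul (h2.add h3)).congr_deriv ?_
    rw [flatOsc, if_neg hx]
    simp only [eval_mul, eval_sub, eval_add, eval_neg, eval_pow, eval_X, Function.comp_apply,
      Pi.mul_apply, Pi.add_apply]
    have h4 : -(x ^ 2)⁻¹ = -(x⁻¹) ^ 2 := by rw [inv_pow]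
    rw [h4]
    push_cast
    ring

theorem contDiff_flatOsc (P Q : ℝ[X]) : ContDiff ℝ ∞ (flatOsc P Q) := by
  rw [contDiff_infty]
  intro n
  induction n generalizing P Q with
  | zero =>
    rw [Nat.cast_zero, contDiff_zero]
    exact continuous_iff_continuousAt.2 fun x => (hasDerivAt_flatOsc P Q x).continuousAt
  | succ n ih =>
    rw [Nat.cast_succ, contDiff_succ_iff_deriv]
    refine ⟨fun x => (hasDerivAt_flatOsc P Q x).differentiableAt, by simp, ?_⟩
    rw [show deriv (flatOsc P Q) = _ from funext fun x => (hasDerivAt_flatOsc P Q x).deriv]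
    exact ih _ _

/-- The exponent of `flatOsc` is halved so that squaring yields e^{-1/x²}. -/
theorem c₀_eq_flatOsc (x : ℝ) : c₀ x = x * flatOsc 1 0 x ^ 2 := by
  by_cases hx : x = 0
  · simp [c₀, hx]
  · rw [flatOsc, if_neg hx, c₀, mul_pow, ← Real.exp_nat_mul, eval_one, eval_zero, zero_mul,
      one_mul, add_zero, one_div, one_div, inv_pow]
    push_cast
    rw [show 2 * -((x ^ 2)⁻¹ / 2) = -(x ^ 2)⁻¹ by ring]
    ring

theorem contDiff_c₀ : ContDiff ℝ ∞ c₀ := by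
  rw [show c₀ = fun x => x * flatOsc 1 0 x ^ 2 from funext c₀_eq_flatOsc]
  exact contDiff_id.mul ((contDiff_flatOsc 1 0).pow 2)

theorem deriv_c₀_zero : deriv c₀ 0 = 0 := by
  rw [show c₀ = fun x => x * flatOsc 1 0 x ^ 2 from funext c₀_eq_flatOsc]
  have h := (hasDerivAt_id (0 : ℝ)).mul ((hasDerivAt_flatOsc 1 0 0).pow 2)
  have h0 : flatOsc 1 0 0 = 0 := if_pos rfl
  refine (show deriv (fun x => x * flatOsc 1 0 x ^ 2) 0 = _ from h.deriv).trans ?_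
  simp [h0]

end Smoothness

/-! ### The shape of `c₀`: bounds, zeros and peaks. -/

open Real

theorem differentiable_c₀ : Differentiable ℝ c₀ := contDiff_c₀.differentiable (by simp)

theorem hasDerivAt_c₀ {x : ℝ} (hx : x ≠ 0) : HasDerivAt c₀ (exp (-(1 / x ^ 2)) * sin (1 / x) *
    ((2 / x ^ 2 + 1) * sin (1 / x) - 2 / x * cos (1 / x))) x := by
  have hi : HasDerivAt (fun x : ℝ => 1 / x) (-(1 / x ^ 2)) x := by
    simpa [one_div] using hasDerivAt_inv hx
  have h1 : HasDerivAt (fun x : ℝ => exp (-(1 / x ^ 2))) (exp (-(1 / x ^ 2)) * (2 / x ^ 3)) x := by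
    have h := (((hasDerivAt_pow 2 x).fun_inv (pow_ne_zero 2 hx)).fun_neg).exp
    simp only [one_div]
    refine h.congr_deriv ?_
    push_cast
    field_simp
  refine ((h1.mul (hasDerivAt_id x)).mul (hi.sin.pow 2)).congr_deriv ?_
  simp only [Pi.pow_apply, Pi.mul_apply, id]
  push_cast
  field_simp
  ring

theorem analyticAt_c₀ {x : ℝ} (hx : x ≠ 0) : AnalyticAt ℝ c₀ x := by
  have h1 : AnalyticAt ℝ (fun x : ℝ => 1 / x) x := analyticAt_const.div analyticAt_id hx
  have h2 : AnalyticAt ℝ (fun x : ℝ => 1 / x ^ 2) x :=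
    analyticAt_const.div (analyticAt_id.pow 2) (pow_ne_zero 2 hx)
  exact ((analyticAt_rexp.fun_comp h2.neg).mul analyticAt_id).mul ((analyticAt_sin.fun_comp h1).pow 2)

theorem c₀_zero : c₀ 0 = 0 := by simp [c₀]

theorem c₀_nonneg {x : ℝ} (hx : 0 ≤ x) : 0 ≤ c₀ x := by
  unfold c₀
  positivity

theorem c₀_nonpos {x : ℝ} (hx : x ≤ 0) : c₀ x ≤ 0 :=
  mul_nonpos_of_nonpos_of_nonneg (mul_nonpos_of_nonneg_of_nonpos (exp_pos _).le hx) (sq_nonneg _)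

theorem c₀_le_self {x : ℝ} (hx : 0 ≤ x) : c₀ x ≤ x := by
  have h1 : exp (-(1 / x ^ 2)) ≤ 1 := exp_le_one_iff.2 (by rw [neg_nonpos]; positivity)
  calc c₀ x ≤ 1 * x * 1 := by
        unfold c₀
        gcongr
        exact sin_sq_le_one _
    _ = x := by ring

/-- This keeps the graph over [0, 1/π] on the near side of the diameter t = 1/(2π) of the disk. -/
theorem c₀_le_half {x : ℝ} (hx : 0 ≤ x) (hx1 : x ≤ 1 / π) : c₀ x ≤ 1 / (2 * π) := by
  rcases hx.eq_or_lt with rfl | h0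
  · rw [c₀_zero]
    positivity
  have h2 : exp (-(1 / x ^ 2)) ≤ 1 / 2 := by
    have h3 : 1 ≤ 1 / x ^ 2 := by
      rw [le_div_iff₀ (by positivity), one_mul]
      have : x ≤ 1 := hx1.trans (by rw [div_le_one pi_pos]; linarith [pi_gt_three])
      nlinarith
    have h4 := add_one_le_exp (1 / x ^ 2)
    rw [exp_neg, inv_eq_one_div]
    exact one_div_le_one_div_of_le (by norm_num) (by linarith)
  calc c₀ x ≤ 1 / 2 * (1 / π) * 1 := by
        unfold c₀
        gcongr
        exact sin_sq_le_one _
    _ = 1 / (2 * π) := by ring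

/-- To the right of `1/π` the function `c₀` grows slowly. -/
theorem c₀_lt_of_inv_pi_lt {x : ℝ} (hx : 1 / π < x) : c₀ x < π * x * (x - 1 / π) := by
  have hx0 : 0 < x := lt_trans (by positivity) hx
  set s := 1 / x with hs
  have hs0 : 0 < s := by positivity
  have hsp : s < π := by
    rw [hs, div_lt_iff₀ hx0]
    rwa [div_lt_iff₀ pi_pos, mul_comm] at hx
  have hxs : x * s = 1 := by rw [hs]; field_simp
  have h1 : sin s < π - s := by
    rw [← sin_pi_sub]
    exact sin_lt (by linarith)
  have h2 : sin s < s := sin_lt hs0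
  have h3 : 0 < sin s := sin_pos_of_pos_of_lt_pi hs0 hsp
  have h4 : exp (-(1 / x ^ 2)) ≤ x ^ 2 := by
    have h := add_one_le_exp (1 / x ^ 2)
    rw [exp_neg]
    refine inv_le_of_inv_le₀ (by positivity) ?_
    rw [← one_div]
    linarith
  have h5 : π * (x - 1 / π) = x * (π - s) := by
    have : π * (1 / π) = 1 := by field_simp
    linear_combination -this + hxs
  -- The factor s will cancel the x in `c₀`, and π − s vanishes together with x − 1/π.
  have h6 : sin s ^ 2 < s * (π - s) := by nlinarith
  calc c₀ x = exp (-(1 / x ^ 2)) * x * sin s ^ 2 := rfl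
    _ < exp (-(1 / x ^ 2)) * x * (s * (π - s)) :=
        mul_lt_mul_of_pos_left h6 (mul_pos (exp_pos _) hx0)
    _ = exp (-(1 / x ^ 2)) * (π - s) := by
        linear_combination exp (-(1 / x ^ 2)) * (π - s) * hxs
    _ ≤ x ^ 2 * (π - s) := mul_le_mul_of_nonneg_right h4 (by linarith)
    _ = π * x * (x - 1 / π) := by linear_combination (-x) * h5

/-- The positive zeros of `c₀`, in decreasing order. -/
noncomputable def zeroPt (k : ℕ) : ℝ := 1 / ((k + 1) * π)

theorem zeroPt_pos (k : ℕ) : 0 < zeroPt k := by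
  unfold zeroPt
  positivity

theorem strictAnti_zeroPt : StrictAnti zeroPt := fun j k hjk => by
  have h : (j : ℝ) < k := by exact_mod_cast hjk
  unfold zeroPt
  gcongr

theorem zeroPt_zero : zeroPt 0 = 1 / π := by simp [zeroPt]

theorem zeroPt_le (k : ℕ) : zeroPt k ≤ 1 / π :=
  zeroPt_zero ▸ strictAnti_zeroPt.antitone (Nat.zero_le k)

theorem tendsto_zeroPt : Filter.Tendsto zeroPt Filter.atTop (𝓝 0) := by
  have h := (tendsto_one_div_add_atTop_nhds_zero_nat (𝕜 := ℝ)).mul_const (1 / π)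
  rw [zero_mul] at h
  refine h.congr fun k => ?_
  unfold zeroPt
  field_simp

theorem sin_one_div_zeroPt (k : ℕ) : sin (1 / zeroPt k) = 0 := by
  rw [zeroPt, one_div_one_div]
  exact_mod_cast sin_nat_mul_pi (k + 1)

theorem c₀_zeroPt (k : ℕ) : c₀ (zeroPt k) = 0 := by
  rw [c₀, sin_one_div_zeroPt]
  simp

theorem deriv_c₀_zeroPt (k : ℕ) : deriv c₀ (zeroPt k) = 0 := by
  rw [(hasDerivAt_c₀ (zeroPt_pos k).ne').deriv, sin_one_div_zeroPt]
  simp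

theorem one_div_mem_of_mem_hump {k : ℕ} {x : ℝ} (hx : x ∈ Ioo (zeroPt (k + 1)) (zeroPt k)) :
    0 < 1 / x - (k + 1) * π ∧ 1 / x - (k + 1) * π < π := by
  have hx0 := (zeroPt_pos _).trans hx.1
  have h1 := one_div_lt_one_div_of_lt (zeroPt_pos _) hx.1
  have h2 := one_div_lt_one_div_of_lt hx0 hx.2
  rw [zeroPt, one_div_one_div] at h1 h2
  push_cast at h1
  constructor <;> linarith

theorem sin_one_div_eq (k : ℕ) (s : ℝ) : sin s = (-1) ^ (k + 1) * sin (s - (k + 1) * π) := by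
  rw [← sin_add_nat_mul_pi]
  push_cast
  ring_nf

/-- The sign of sin(1/x) is constant on a hump; the product form hides its dependence on the parity
of k. -/
theorem sin_mul_sin_pos {k : ℕ} {x y : ℝ} (hx : x ∈ Ioo (zeroPt (k + 1)) (zeroPt k))
    (hy : y ∈ Ioo (zeroPt (k + 1)) (zeroPt k)) : 0 < sin (1 / x) * sin (1 / y) := by
  obtain ⟨h1, h2⟩ := one_div_mem_of_mem_hump hx
  obtain ⟨h3, h4⟩ := one_div_mem_of_mem_hump hy
  have h5 := mul_pos (sin_pos_of_pos_of_lt_pi h1 h2) (sin_pos_of_pos_of_lt_pi h3 h4)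
  rw [sin_one_div_eq k (1 / x), sin_one_div_eq k (1 / y), mul_mul_mul_comm, ← mul_pow]
  simpa using h5

theorem c₀_pos_of_mem_hump {k : ℕ} {x : ℝ} (hx : x ∈ Ioo (zeroPt (k + 1)) (zeroPt k)) :
    0 < c₀ x := by
  have h := sin_mul_sin_pos hx hx
  have hx0 := (zeroPt_pos _).trans hx.1
  rw [← sq] at h
  exact mul_pos (mul_pos (exp_pos _) hx0) h

theorem critical_eq {k : ℕ} {x : ℝ} (hx : x ∈ Ioo (zeroPt (k + 1)) (zeroPt k))
    (h : deriv c₀ x = 0) :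
    (2 * (1 / x) ^ 2 + 1) * sin (1 / x) = 2 * (1 / x) * cos (1 / x) := by
  have hx0 := (zeroPt_pos _).trans hx.1
  have hs : sin (1 / x) ≠ 0 := fun h0 => by
    have := sin_mul_sin_pos hx hx
    rw [h0, zero_mul] at this
    exact lt_irrefl _ this
  rw [(hasDerivAt_c₀ hx0.ne').deriv, mul_eq_zero, mul_eq_zero] at h
  rcases h with (h | h) | h
  · exact absurd h (exp_pos _).ne'
  · exact absurd h hs
  · rw [sub_eq_zero] at h
    convert h using 2
    · field_simp
    · field_simp

/-- With s = 1/x the critical equation reads cot s = s + 1/(2s). On a hump s > 1, so the right side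
increases while cot decreases between consecutive multiples of π: there is at most one solution. -/
theorem not_lt_of_critical {k : ℕ} {x y : ℝ} (hx : x ∈ Ioo (zeroPt (k + 1)) (zeroPt k))
    (hy : y ∈ Ioo (zeroPt (k + 1)) (zeroPt k)) (hdx : deriv c₀ x = 0) (hdy : deriv c₀ y = 0) :
    ¬ x < y := by
  intro hxy
  have hx0 := (zeroPt_pos _).trans hx.1
  have hy0 := (zeroPt_pos _).trans hy.1
  have h1 := critical_eq hx hdx
  have h2 := critical_eq hy hdy
  have h3 := sin_mul_sin_pos hx hy
  have h4 := one_div_lt_one_div_of_lt hx0 hxy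
  have h5 := one_div_mem_of_mem_hump hx
  have h6 := one_div_mem_of_mem_hump hy
  have hk : (0 : ℝ) ≤ k := Nat.cast_nonneg k
  have hpi := pi_gt_three
  have hkpi : 0 ≤ k * π := by positivity
  set s := 1 / x
  set r := 1 / y
  have hr : 1 < r := by nlinarith
  have hsin : 0 < sin (s - r) := sin_pos_of_pos_of_lt_pi (by linarith) (by linarith)
  rw [sin_sub] at hsin
  -- The difference of the two critical equations, cleared of denominators; the left side is 2sr
  -- sin(s − r) > 0, the right side is negative.
  have h7 : 2 * s * r * (sin s * cos r - cos s * sin r) =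
      sin s * sin r * ((s - r) * (1 - 2 * s * r)) := by
    linear_combination (-s * sin s) * h2 + (r * sin r) * h1
  have h8 : (s - r) * (1 - 2 * s * r) < 0 :=
    mul_neg_of_pos_of_neg (by linarith) (by nlinarith)
  have h9 : 0 < 2 * s * r * (sin s * cos r - cos s * sin r) := by
    have : 0 < s := by linarith
    positivity
  rw [h7] at h9
  exact absurd h9 (not_lt.2 (mul_nonpos_of_nonneg_of_nonpos h3.le h8.le))

theorem exists_peak (k : ℕ) : ∃ a ∈ Ioo (zeroPt (k + 1)) (zeroPt k), deriv c₀ a = 0 ∧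
    ∀ x ∈ Icc (zeroPt (k + 1)) (zeroPt k), c₀ x ≤ c₀ a := by
  have hlt := strictAnti_zeroPt (Nat.lt_succ_self k)
  obtain ⟨a, ha, hmax⟩ := isCompact_Icc.exists_isMaxOn (nonempty_Icc.2 hlt.le)
    contDiff_c₀.continuous.continuousOn
  obtain ⟨b, hb⟩ := exists_between hlt
  have hpos : 0 < c₀ a := (c₀_pos_of_mem_hump hb).trans_le (hmax (Ioo_subset_Icc_self hb))
  have ha' : a ∈ Ioo (zeroPt (k + 1)) (zeroPt k) := by
    refine ⟨lt_of_le_of_ne ha.1 ?_, lt_of_le_of_ne ha.2 ?_⟩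
    · rintro rfl
      exact hpos.ne' (c₀_zeroPt _)
    · rintro rfl
      exact hpos.ne' (c₀_zeroPt _)
  exact ⟨a, ha', (hmax.isLocalMax (Icc_mem_nhds ha'.1 ha'.2)).deriv_eq_zero, fun x hx => hmax hx⟩

/-- The point between two consecutive zeros at which `c₀` is maximal. -/
noncomputable def peak (k : ℕ) : ℝ := (exists_peak k).choose

theorem peak_mem (k : ℕ) : peak k ∈ Ioo (zeroPt (k + 1)) (zeroPt k) :=
  (exists_peak k).choose_spec.1

theorem deriv_c₀_peak (k : ℕ) : deriv c₀ (peak k) = 0 := (exists_peak k).choose_spec.2.1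

theorem c₀_le_peak {k : ℕ} {x : ℝ} (hx : x ∈ Icc (zeroPt (k + 1)) (zeroPt k)) :
    c₀ x ≤ c₀ (peak k) := (exists_peak k).choose_spec.2.2 x hx

theorem eq_peak {k : ℕ} {x : ℝ} (hx : x ∈ Ioo (zeroPt (k + 1)) (zeroPt k))
    (h : deriv c₀ x = 0) : x = peak k :=
  le_antisymm (not_lt.1 (not_lt_of_critical (peak_mem k) hx (deriv_c₀_peak k) h))
    (not_lt.1 (not_lt_of_critical hx (peak_mem k) h (deriv_c₀_peak k)))

theorem peak_pos (k : ℕ) : 0 < peak k := (zeroPt_pos _).trans (peak_mem k).1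

theorem c₀_peak_pos (k : ℕ) : 0 < c₀ (peak k) := c₀_pos_of_mem_hump (peak_mem k)

theorem c₀_peak_le (k : ℕ) : c₀ (peak k) ≤ zeroPt k :=
  (c₀_le_self (peak_pos k).le).trans (peak_mem k).2.le

theorem eq_peak_of_c₀_eq {k : ℕ} {x : ℝ} (hx : x ∈ Icc (zeroPt (k + 1)) (zeroPt k))
    (h : c₀ x = c₀ (peak k)) : x = peak k := by
  have hpos := c₀_peak_pos k
  have hx' : x ∈ Ioo (zeroPt (k + 1)) (zeroPt k) := by
    refine ⟨lt_of_le_of_ne hx.1 ?_, lt_of_le_of_ne hx.2 ?_⟩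
    · rintro rfl
      exact hpos.ne (c₀_zeroPt (k + 1) ▸ h)
    · rintro rfl
      exact hpos.ne (c₀_zeroPt k ▸ h)
  refine eq_peak hx' (IsLocalMax.deriv_eq_zero ?_)
  filter_upwards [Ioo_mem_nhds hx'.1 hx'.2] with y hy
  rw [h]
  exact c₀_le_peak (Ioo_subset_Icc_self hy)

/-- Replacing s = 1/x by s − π preserves sin² s and increases e^{-s²}/s, so the next larger hump
takes a value above the given peak. -/
theorem strictAnti_c₀_peak : StrictAnti fun k => c₀ (peak k) := by
  refine strictAnti_nat_of_succ_lt fun k => ?_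
  obtain ⟨h1, h2⟩ := one_div_mem_of_mem_hump (peak_mem (k + 1))
  set s := 1 / peak (k + 1) with hs
  push_cast at h1 h2
  have hpi := pi_pos
  have hkpi : 0 ≤ k * π := by positivity
  have hs0 : 0 < s - π := by linarith
  have hval : ∀ r : ℝ, r ≠ 0 → c₀ (1 / r) = exp (-r ^ 2) * (1 / r) * sin r ^ 2 := fun r hr => by
    rw [c₀, one_div_one_div]
    congr 4
    field_simp
  have hp : peak (k + 1) = 1 / s := by rw [hs, one_div_one_div]
  have hsin : sin (s - π) ^ 2 = sin s ^ 2 := by rw [sin_sub_pi, neg_sq]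
  have hne : 0 < sin s ^ 2 := by
    have := sin_mul_sin_pos (peak_mem (k + 1)) (peak_mem (k + 1))
    rwa [← sq] at this
  have hmem : 1 / (s - π) ∈ Icc (zeroPt (k + 1)) (zeroPt k) := by
    unfold zeroPt
    constructor
    · apply one_div_le_one_div_of_le hs0
      push_cast
      linarith
    · apply one_div_le_one_div_of_le (by positivity)
      linarith
  refine lt_of_lt_of_le ?_ (c₀_le_peak hmem)
  rw [hp, hval s (by linarith), hval (s - π) hs0.ne', hsin]
  refine mul_lt_mul_of_pos_right ?_ hne
  refine mul_lt_mul'' ?_ ?_ (exp_pos _).le (one_div_nonneg.2 (by linarith))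
  · rw [exp_lt_exp]
    nlinarith
  · exact one_div_lt_one_div_of_lt hs0 (by linarith)

theorem tendsto_c₀_peak : Filter.Tendsto (fun k => c₀ (peak k)) Filter.atTop (𝓝 0) :=
  squeeze_zero (fun k => (c₀_peak_pos k).le) c₀_peak_le tendsto_zeroPt

theorem mem_hump_or {x : ℝ} (hx0 : 0 < x) (hx1 : x ≤ 1 / π) :
    (∃ k, x = zeroPt k) ∨ ∃ k, x ∈ Ioo (zeroPt (k + 1)) (zeroPt k) := by
  classical
  have hex : ∃ n, zeroPt n ≤ x :=
    ((tendsto_zeroPt.eventually (gt_mem_nhds hx0)).exists).imp fun n hn => hn.le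
  rcases hn : Nat.find hex with _ | n
  · have h := Nat.find_spec hex
    rw [hn, zeroPt_zero] at h
    exact Or.inl ⟨0, by rw [zeroPt_zero, le_antisymm hx1 h]⟩
  · have h := Nat.find_spec hex
    have h' := Nat.find_min hex (m := n) (by omega)
    rw [hn] at h
    rcases h.eq_or_lt with h | h
    · exact Or.inl ⟨n + 1, h.symm⟩
    · exact Or.inr ⟨n, h, not_le.1 h'⟩

theorem eq_zeroPt_or_eq_peak {x : ℝ} (hx0 : 0 < x) (hx1 : x ≤ 1 / π) (h : deriv c₀ x = 0) :
    (∃ k, x = zeroPt k) ∨ ∃ k, x = peak k := by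
  rcases mem_hump_or hx0 hx1 with h' | ⟨k, hk⟩
  · exact Or.inl h'
  · exact Or.inr ⟨k, eq_peak hk h⟩

/-- The maximum of `c₀` on `[0, zeroPt k]` is attained only at the peak number `k`. -/
theorem c₀_le_peak_of_le {k : ℕ} {x : ℝ} (hx0 : 0 ≤ x) (hx : x ≤ zeroPt k) :
    c₀ x ≤ c₀ (peak k) ∧ (c₀ x = c₀ (peak k) → x = peak k) := by
  rcases hx0.eq_or_lt with rfl | hx0
  · rw [c₀_zero]
    exact ⟨(c₀_peak_pos k).le, fun h => absurd h (c₀_peak_pos k).ne⟩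
  rcases mem_hump_or hx0 (hx.trans (zeroPt_le k)) with ⟨j, rfl⟩ | ⟨j, hj⟩
  · rw [c₀_zeroPt]
    exact ⟨(c₀_peak_pos k).le, fun h => absurd h (c₀_peak_pos k).ne⟩
  · have hkj : k ≤ j := by
      have := strictAnti_zeroPt.lt_iff_gt.1 (hj.1.trans_le hx)
      omega
    have h1 := c₀_le_peak (Ioo_subset_Icc_self hj)
    have h2 := strictAnti_c₀_peak.antitone hkj
    refine ⟨h1.trans h2, fun h => ?_⟩
    obtain rfl := strictAnti_c₀_peak.injective (le_antisymm (h ▸ h1) h2)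
    exact eq_peak_of_c₀_eq (Ioo_subset_Icc_self hj) h

/-! ### The running maximum of `c₀`. -/

/-- The point of `[0, 1/π]` nearest to `x`. -/
noncomputable def clampPi (x : ℝ) : ℝ := max 0 (min x (1 / π))

theorem clampPi_mem (x : ℝ) : clampPi x ∈ Icc 0 (1 / π) :=
  ⟨le_max_left _ _, max_le (by positivity) (min_le_right _ _)⟩

theorem clampPi_of_mem {x : ℝ} (hx : x ∈ Icc 0 (1 / π)) : clampPi x = x := by
  rw [clampPi, min_eq_left hx.2, max_eq_right hx.1]

theorem monotone_clampPi : Monotone clampPi := fun x y h => by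
  unfold clampPi
  gcongr

theorem continuous_clampPi : Continuous clampPi := by
  unfold clampPi
  fun_prop

/-- The running maximum of `c₀` on `[0, 1/π]`. -/
noncomputable def runMax (x : ℝ) : ℝ := sSup ((fun s => c₀ (s * clampPi x)) '' Icc 0 1)

/-- Rescaling the varying interval to [0, 1] makes this a supremum of a jointly continuous function
over a fixed compact set. -/
theorem continuous_runMax : Continuous runMax := by
  refine isCompact_Icc.continuous_sSup (f := fun x s => c₀ (s * clampPi x)) ?_
  have := continuous_clampPi
  have := contDiff_c₀.continuous
  simp only [Function.HasUncurry.uncurry, id]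
  fun_prop

theorem isGreatest_runMax (x : ℝ) : IsGreatest (c₀ '' Icc 0 (clampPi x)) (runMax x) := by
  have h : (fun s => c₀ (s * clampPi x)) '' Icc 0 1 = c₀ '' Icc 0 (clampPi x) := by
    rw [← image_image c₀ (fun s => s * clampPi x)]
    congr 1
    rcases (clampPi_mem x).1.eq_or_lt with h0 | h0
    · rw [← h0]
      simp
    · rw [image_mul_right_Icc (by norm_num) h0.le]
      simp
  rw [← h]
  refine IsCompact.isGreatest_sSup ?_ ((nonempty_Icc.2 zero_le_one).image _)
  have := contDiff_c₀.continuous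
  exact isCompact_Icc.image (by fun_prop)

theorem c₀_le_runMax {x y : ℝ} (hy : y ∈ Icc 0 (clampPi x)) : c₀ y ≤ runMax x :=
  (isGreatest_runMax x).2 (mem_image_of_mem _ hy)

theorem runMax_le_half (x : ℝ) : runMax x ≤ 1 / (2 * π) := by
  obtain ⟨m, hm, h⟩ := (isGreatest_runMax x).1
  rw [← h]
  exact c₀_le_half hm.1 (hm.2.trans (clampPi_mem x).2)

theorem monotone_runMax : Monotone runMax := fun x y h => by
  obtain ⟨m, hm, he⟩ := (isGreatest_runMax x).1
  rw [← he]
  exact c₀_le_runMax ⟨hm.1, hm.2.trans (monotone_clampPi h)⟩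

theorem runMax_of_nonpos {x : ℝ} (hx : x ≤ 0) : runMax x = 0 := by
  obtain ⟨m, hm, he⟩ := (isGreatest_runMax x).1
  have h0 : clampPi x = 0 := max_eq_left ((min_le_left _ _).trans hx)
  rw [h0] at hm
  rw [← he, le_antisymm hm.2 hm.1, c₀_zero]

theorem runMax_zeroPt (k : ℕ) : runMax (zeroPt k) = c₀ (peak k) := by
  have hc : clampPi (zeroPt k) = zeroPt k := clampPi_of_mem ⟨(zeroPt_pos k).le, zeroPt_le k⟩
  apply le_antisymm
  · obtain ⟨m, hm, he⟩ := (isGreatest_runMax (zeroPt k)).1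
    rw [hc] at hm
    rw [← he]
    exact (c₀_le_peak_of_le hm.1 hm.2).1
  · exact c₀_le_runMax (by rw [hc]; exact ⟨(peak_pos k).le, (peak_mem k).2.le⟩)

theorem runMax_peak (k : ℕ) : runMax (peak k) = c₀ (peak k) := by
  apply le_antisymm
  · rw [← runMax_zeroPt k]
    exact monotone_runMax (peak_mem k).2.le
  · exact c₀_le_runMax (by
      rw [clampPi_of_mem ⟨(peak_pos k).le, (peak_mem k).2.le.trans (zeroPt_le k)⟩]
      exact ⟨(peak_pos k).le, le_rfl⟩)

theorem exists_eq_peak_of_interior_max {a b m : ℝ} (ha : 0 ≤ a) (hb : b ≤ 1 / π) (hm : m ∈ Ioo a b)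
    (hmax : ∀ x ∈ Icc a b, c₀ x ≤ c₀ m) (hpos : 0 < c₀ m) : ∃ k, m = peak k := by
  have hd : deriv c₀ m = 0 := by
    refine IsLocalMax.deriv_eq_zero ?_
    filter_upwards [Icc_mem_nhds hm.1 hm.2] with x hx using hmax x hx
  rcases eq_zeroPt_or_eq_peak (ha.trans_lt hm.1) (hm.2.le.trans hb) hd with ⟨k, rfl⟩ | h
  · exact absurd (c₀_zeroPt k) hpos.ne'
  · exact h

/-- Above a point of height `t` which does not see the origin, the running maximum is the height
of a peak. -/
theorem exists_runMax_eq {x t : ℝ} (ht : 0 ≤ t) (hx : c₀ (clampPi x) ≤ t) (h : t < runMax x) :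
    ∃ k, runMax x = c₀ (peak k) := by
  obtain ⟨m, hm, he⟩ := (isGreatest_runMax x).1
  have hmem : m ∈ Ioo 0 (clampPi x) := by
    refine ⟨lt_of_le_of_ne hm.1 ?_, lt_of_le_of_ne hm.2 ?_⟩
    · rintro rfl
      rw [c₀_zero] at he
      linarith
    · rintro rfl
      linarith
  obtain ⟨k, rfl⟩ := exists_eq_peak_of_interior_max le_rfl (clampPi_mem x).2 hmem
    (fun y hy => he ▸ c₀_le_runMax hy) (by linarith)
  exact ⟨k, he.symm⟩

/-- A place between x and y higher than t would give an interior maximum, at some peak. Equality of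
the running maxima puts a point at least as high to its left, but up to the end of its hump `c₀` is
maximal only at that peak. -/
theorem c₀_le_of_max_runMax_eq {x y t : ℝ} (ht : 0 ≤ t) (hxy : x ≤ y) (hx : c₀ (clampPi x) ≤ t)
    (hy : c₀ (clampPi y) ≤ t) (h : max t (runMax x) = max t (runMax y)) :
    ∀ w ∈ Icc (clampPi x) (clampPi y), c₀ w ≤ t := by
  intro w hw
  rcases le_or_gt (runMax y) t with hyt | hyt
  · exact (c₀_le_runMax ⟨(clampPi_mem x).1.trans hw.1, hw.2⟩).trans hyt
  have hM : runMax x = runMax y := by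
    rw [max_eq_right hyt.le] at h
    rcases max_choice t (runMax x) with h' | h' <;> rw [h'] at h
    · exact absurd h hyt.ne
    · exact h
  by_contra hwt
  rw [not_le] at hwt
  obtain ⟨m, hm, hmax⟩ := isCompact_Icc.exists_isMaxOn (nonempty_Icc.2 (monotone_clampPi hxy))
    contDiff_c₀.continuous.continuousOn
  have hmt : t < c₀ m := hwt.trans_le (hmax hw)
  have hmem : m ∈ Ioo (clampPi x) (clampPi y) := by
    refine ⟨lt_of_le_of_ne hm.1 ?_, lt_of_le_of_ne hm.2 ?_⟩
    · rintro rfl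
      linarith
    · rintro rfl
      linarith
  obtain ⟨k, rfl⟩ := exists_eq_peak_of_interior_max (clampPi_mem x).1 (clampPi_mem y).2 hmem
    (fun y hy => hmax hy) (by linarith)
  obtain ⟨n, hn, he⟩ := (isGreatest_runMax x).1
  have hnk : n < peak k := hn.2.trans_lt hmem.1
  obtain ⟨h1, h2⟩ := c₀_le_peak_of_le hn.1 (hnk.trans (peak_mem k).2).le
  have h3 : c₀ (peak k) ≤ runMax y := c₀_le_runMax ⟨(peak_pos k).le, hm.2⟩
  exact hnk.ne (h2 (le_antisymm h1 (by rw [he, hM]; exact h3)))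

/-- Converse of the previous lemma: whatever the running maximum gains between x and y stays at most
t. -/
theorem max_runMax_eq {x y t : ℝ} (hxy : x ≤ y)
    (h : ∀ w ∈ Icc (clampPi x) (clampPi y), c₀ w ≤ t) :
    max t (runMax x) = max t (runMax y) := by
  refine le_antisymm (max_le_max le_rfl (monotone_runMax hxy)) (max_le (le_max_left _ _) ?_)
  obtain ⟨n, hn, he⟩ := (isGreatest_runMax y).1
  rw [← he]
  rcases le_total n (clampPi x) with h' | h'
  · exact le_max_of_le_right (c₀_le_runMax ⟨hn.1, h'⟩)
  · exact le_max_of_le_left (h n ⟨h', hn.2⟩)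

/-! ### Zero sets of submersions are submanifolds. -/

/-- A surjective linear map between Euclidean spaces is the second component of a linear
isomorphism. -/
theorem exists_equiv_prod_of_surjective {d k n : ℕ} (hn : n = d + k)
    (L : EuclideanSpace ℝ (Fin n) →L[ℝ] EuclideanSpace ℝ (Fin k)) (hL : Function.Surjective L) :
    ∃ (A : EuclideanSpace ℝ (Fin n) →L[ℝ] EuclideanSpace ℝ (Fin d))
      (e : EuclideanSpace ℝ (Fin n) ≃L[ℝ] EuclideanSpace ℝ (Fin d) × EuclideanSpace ℝ (Fin k)),
      (e : EuclideanSpace ℝ (Fin n) →L[ℝ] _) = A.prod L := by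
  have hker : Module.finrank ℝ (LinearMap.ker L.toLinearMap) =
      Module.finrank ℝ (EuclideanSpace ℝ (Fin d)) := by
    have h := LinearMap.finrank_range_add_finrank_ker L.toLinearMap
    rw [LinearMap.range_eq_top.2 hL, finrank_top, finrank_euclideanSpace_fin,
      finrank_euclideanSpace_fin] at h
    rw [finrank_euclideanSpace_fin]
    omega
  let f := LinearEquiv.ofFinrankEq _ _ hker
  -- A linear projection onto the kernel supplies the d missing coordinates.
  obtain ⟨g, hg⟩ := LinearMap.exists_leftInverse_of_injective
    (LinearMap.ker L.toLinearMap).subtype (Submodule.ker_subtype _)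
  let A : EuclideanSpace ℝ (Fin n) →ₗ[ℝ] EuclideanSpace ℝ (Fin d) := f.toLinearMap ∘ₗ g
  have hinj : Function.Injective (A.prod L.toLinearMap) := by
    rw [← LinearMap.ker_eq_bot, LinearMap.ker_eq_bot']
    intro v hv
    obtain ⟨h1, h2⟩ := Prod.mk.inj hv
    have h3 : g v = 0 := f.map_eq_zero_iff.1 h1
    have h4 := LinearMap.congr_fun hg ⟨v, LinearMap.mem_ker.2 h2⟩
    simp only [LinearMap.comp_apply, Submodule.subtype_apply, LinearMap.id_apply, h3] at h4
    exact (congrArg Subtype.val h4).symm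
  have hsurj : Function.Surjective (A.prod L.toLinearMap) :=
    (LinearMap.injective_iff_surjective_of_finrank_eq_finrank (by
      rw [Module.finrank_prod, finrank_euclideanSpace_fin, finrank_euclideanSpace_fin,
        finrank_euclideanSpace_fin, hn])).1 hinj
  refine ⟨LinearMap.toContinuousLinearMap A,
    (LinearEquiv.ofBijective _ ⟨hinj, hsurj⟩).toContinuousLinearEquiv, ?_⟩
  ext v : 1
  rfl

/-- The zero set of a smooth map whose derivative is surjective at each zero is a submanifold. -/
theorem isSmoothSubmanifold_preimage_zero {d k n : ℕ} (hn : n = d + k)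
    {f : EuclideanSpace ℝ (Fin n) → EuclideanSpace ℝ (Fin k)} (hf : ContDiff ℝ ∞ f)
    (hs : ∀ x, f x = 0 → Function.Surjective (fderiv ℝ f x)) :
    IsSmoothSubmanifold d (f ⁻¹' {0}) := by
  refine ⟨k, hn, fun x hx => ?_⟩
  obtain ⟨A, e, he⟩ := exists_equiv_prod_of_surjective hn (fderiv ℝ f x) (hs x hx)
  let g := fun y => (A y, f y)
  have hg : ContDiff ℝ ∞ g := A.contDiff.prodMk hf
  have hd : ∀ y, HasFDerivAt g (A.prod (fderiv ℝ f y)) y := fun y =>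
    A.hasFDerivAt.prodMk (hf.differentiable (by simp) y).hasFDerivAt
  have hgx : HasFDerivAt g (e : EuclideanSpace ℝ (Fin n) →L[ℝ] _) x := he ▸ hd x
  -- Smoothness of the inverse is needed on the whole target, so the chart is restricted to the
  -- points where the derivative is invertible.
  let V := {y | fderiv ℝ g y ∈ range ((↑) : (EuclideanSpace ℝ (Fin n) ≃L[ℝ]
    EuclideanSpace ℝ (Fin d) × EuclideanSpace ℝ (Fin k)) → _)}
  have hV : IsOpen V := ContinuousLinearEquiv.isOpen.preimage (hg.continuous_fderiv (by simp))
  let φ := (hg.contDiffAt.toOpenPartialHomeomorph g hgx (by simp)).restrOpen V hV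
  have hφ : ∀ y, φ y = g y := fun y => rfl
  refine ⟨φ, ⟨hg.contDiffAt.mem_toOpenPartialHomeomorph_source hgx (by simp), e, hgx.fderiv.symm⟩,
    hg.contDiffOn, ?_, fun y _ => Iff.rfl⟩
  intro z hz
  obtain ⟨e', he'⟩ := (φ.map_target hz).2
  refine (φ.contDiffAt_symm (f₀' := e') hz ?_ hg.contDiffAt).contDiffWithinAt
  rw [he']
  exact (hg.differentiable (by simp) _).hasFDerivAt

/-! ### The map `eMap` in coordinates: smoothness and analyticity. -/

section Coordinates

variable (m₁ m₂ : ℕ)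

/-- The coordinates `(x₁, x₂, y, z)` on `ℝ^{m₁+m₂+2}`. -/
noncomputable def coords : EuclideanSpace ℝ (Fin (m₁ + m₂ + 2)) ≃L[ℝ]
    ℝ × ℝ × EuclideanSpace ℝ (Fin m₁) × EuclideanSpace ℝ (Fin m₂) :=
  LinearEquiv.toContinuousLinearEquiv
    { toFun := fun x => (x 0, x 1, WithLp.toLp 2 fun j => x ⟨2 + j, by have := j.isLt; omega⟩,
        WithLp.toLp 2 fun j => x ⟨2 + m₁ + j, by have := j.isLt; omega⟩)
      map_add' := fun x y => rfl
      map_smul' := fun c x => rfl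
      invFun := fun p => WithLp.toLp 2 fun i =>
        if i.val = 0 then p.1 else if i.val = 1 then p.2.1 else
        if h : i.val < 2 + m₁ then
          -- The value 0 is never used: the indices 0 and 1 have been dealt with.
          if h' : 2 ≤ i.val then p.2.2.1 ⟨i.val - 2, by omega⟩ else 0
        else p.2.2.2 ⟨i.val - (2 + m₁), by have := i.isLt; omega⟩
      left_inv := fun x => by
        ext ⟨i, hi⟩
        simp only
        split_ifs with h0 h1 h2 h3
        · subst h0
          rfl
        · subst h1
          rfl
        · exact congrArg (fun k => x k) (Fin.ext (show 2 + (i - 2) = i by omega))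
        · omega
        · exact congrArg (fun k => x k) (Fin.ext (show 2 + m₁ + (i - (2 + m₁)) = i by omega))
      right_inv := fun p => by
        refine Prod.ext rfl (Prod.ext rfl (Prod.ext ?_ ?_))
        · ext ⟨j, hj⟩
          simp only
          rw [if_neg (by omega), if_neg (by omega), dif_pos (by omega), dif_pos (by omega)]
          exact congrArg (fun k => p.2.2.1 k) (Fin.ext (show 2 + j - 2 = j by omega))
        · ext ⟨j, hj⟩
          simp only
          rw [if_neg (by omega), if_neg (by omega), dif_neg (by omega)]
          exact congrArg (fun k => p.2.2.2 k)
            (Fin.ext (show 2 + m₁ + j - (2 + m₁) = j by omega)) }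

variable {m₁ m₂}

/-- The first component of `eMap` in the coordinates `(x₁, x₂, y, z)`. -/
noncomputable def leftFun
    (q : ℝ × ℝ × EuclideanSpace ℝ (Fin m₁) × EuclideanSpace ℝ (Fin m₂)) : ℝ :=
  q.1 - c₀ q.2.1 - ‖q.2.2.1‖ ^ 2

/-- The equation of the disk of which `(0, 0)`, `(0, 1/π)`, `(1/π, 0)` and `(1/π, 1/π)` are
boundary points. -/
noncomputable def disk (t x : ℝ) : ℝ := t * (1 / π - t) + x * (1 / π - x)

/-- The second component of `eMap` in the coordinates `(x₁, x₂, y, z)`. -/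
noncomputable def rightFun
    (q : ℝ × ℝ × EuclideanSpace ℝ (Fin m₁) × EuclideanSpace ℝ (Fin m₂)) : ℝ :=
  disk q.1 q.2.1 - ‖q.2.2.2‖ ^ 2

variable (m₁ m₂) in
/-- The map `eMap` for the parameters chosen here. -/
noncomputable abbrev oscMap :
    EuclideanSpace ℝ (Fin (m₁ + m₂ + 2)) → EuclideanSpace ℝ (Fin 2) :=
  eMap (1 / (2 * π)) (1 / (2 * π)) 1 1 (1 / (2 * π ^ 2)) m₁ m₂

variable (m₁ m₂) in
/-- The zero set of `eMap` for the parameters chosen here. -/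
noncomputable abbrev oscManifold : Set (EuclideanSpace ℝ (Fin (m₁ + m₂ + 2))) :=
  zeroManifold (1 / (2 * π)) (1 / (2 * π)) 1 1 (1 / (2 * π ^ 2)) m₁ m₂

theorem disk_eq (t x : ℝ) : disk t x =
    1 / (2 * π ^ 2) - ((t - 1 / (2 * π)) ^ 2 / 1 + (x - 1 / (2 * π)) ^ 2 / 1) := by
  unfold disk
  field_simp
  ring

theorem oscMap_eq (x : EuclideanSpace ℝ (Fin (m₁ + m₂ + 2))) :
    oscMap m₁ m₂ x = !₂[leftFun (coords m₁ m₂ x), rightFun (coords m₁ m₂ x)] := by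
  rw [leftFun, rightFun, EuclideanSpace.real_norm_sq_eq, EuclideanSpace.real_norm_sq_eq, disk_eq]
  rfl

theorem mem_oscManifold {x : EuclideanSpace ℝ (Fin (m₁ + m₂ + 2))} : x ∈ oscManifold m₁ m₂ ↔
    leftFun (coords m₁ m₂ x) = 0 ∧ rightFun (coords m₁ m₂ x) = 0 := by
  show oscMap m₁ m₂ x = 0 ↔ _
  rw [oscMap_eq]
  constructor
  · intro h
    exact ⟨congrArg (fun v : EuclideanSpace ℝ (Fin 2) => v 0) h,
      congrArg (fun v : EuclideanSpace ℝ (Fin 2) => v 1) h⟩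
  · rintro ⟨h1, h2⟩
    rw [h1, h2]
    ext i
    fin_cases i <;> rfl

theorem contDiff_leftFun : ContDiff ℝ ∞ (leftFun (m₁ := m₁) (m₂ := m₂)) := by
  unfold leftFun
  have h := contDiff_c₀
  exact (contDiff_fst.sub (h.comp (contDiff_fst.comp contDiff_snd))).sub
    ((contDiff_fst.comp (contDiff_snd.comp contDiff_snd)).norm_sq ℝ)

theorem contDiff_rightFun : ContDiff ℝ ∞ (rightFun (m₁ := m₁) (m₂ := m₂)) := by
  unfold rightFun disk
  have h : ContDiff ℝ ∞ fun q : ℝ × ℝ × EuclideanSpace ℝ (Fin m₁) × EuclideanSpace ℝ (Fin m₂) =>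
      q.2.2.2 := by fun_prop
  exact ContDiff.sub (by fun_prop) (h.norm_sq ℝ)

theorem contDiff_oscMap : ContDiff ℝ ∞ (oscMap m₁ m₂) := by
  rw [show oscMap m₁ m₂ = _ from funext oscMap_eq, contDiff_euclidean]
  intro i
  fin_cases i
  · exact contDiff_leftFun.comp (coords m₁ m₂).contDiff
  · exact contDiff_rightFun.comp (coords m₁ m₂).contDiff

/-- The map `eMap` is analytic off a hyperplane. -/
theorem analyticAt_oscMap {x : EuclideanSpace ℝ (Fin (m₁ + m₂ + 2))} (hx : x 1 ≠ 0) :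
    AnalyticAt ℝ (oscMap m₁ m₂) x := by
  have hproj : ∀ i, AnalyticAt ℝ (fun x : EuclideanSpace ℝ (Fin (m₁ + m₂ + 2)) => x i) x :=
    fun i => (EuclideanSpace.proj (𝕜 := ℝ) i).analyticAt x
  have h0 : AnalyticAt ℝ (fun x : EuclideanSpace ℝ (Fin (m₁ + m₂ + 2)) =>
      x 0 - c₀ (x 1) - ∑ j : Fin m₁, x ⟨2 + j, by have := j.isLt; omega⟩ ^ 2) x := by
    refine ((hproj 0).sub (AnalyticAt.fun_comp (g := c₀)
      (f := fun x : EuclideanSpace ℝ (Fin (m₁ + m₂ + 2)) => x 1) (analyticAt_c₀ hx) (hproj 1))).sub ?_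
    exact Finset.analyticAt_fun_sum _ fun j _ => (hproj _).pow 2
  have h1 : AnalyticAt ℝ (fun x : EuclideanSpace ℝ (Fin (m₁ + m₂ + 2)) =>
      1 / (2 * π ^ 2) - ((x 0 - 1 / (2 * π)) ^ 2 / 1 + (x 1 - 1 / (2 * π)) ^ 2 / 1)
        - ∑ j : Fin m₂, x ⟨2 + m₁ + j, by have := j.isLt; omega⟩ ^ 2) x := by
    refine (analyticAt_const.sub (AnalyticAt.add ?_ ?_)).sub ?_
    · exact (((hproj 0).sub analyticAt_const).pow 2).div analyticAt_const one_ne_zero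
    · exact (((hproj 1).sub analyticAt_const).pow 2).div analyticAt_const one_ne_zero
    · exact Finset.analyticAt_fun_sum _ fun j _ => (hproj _).pow 2
  have h2 : AnalyticAt ℝ (fun x => WithLp.ofLp (oscMap m₁ m₂ x)) x := by
    rw [analyticAt_pi_iff]
    intro i
    fin_cases i
    · exact h0
    · exact h1
  exact ((EuclideanSpace.equiv (Fin 2) ℝ).symm.toContinuousLinearMap.analyticAt _).fun_comp h2

theorem volume_setOf_eq_zero {n : ℕ} (i : Fin n) :
    volume {x : EuclideanSpace ℝ (Fin n) | x i = 0} = 0 := by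
  have h := Measure.addHaar_submodule (volume : Measure (EuclideanSpace ℝ (Fin n)))
    (LinearMap.ker (EuclideanSpace.proj (𝕜 := ℝ) i : EuclideanSpace ℝ (Fin n) →L[ℝ] ℝ).toLinearMap)
    (fun h => by
      have h1 : EuclideanSpace.single i (1 : ℝ) ∈ LinearMap.ker
          (EuclideanSpace.proj (𝕜 := ℝ) i : EuclideanSpace ℝ (Fin n) →L[ℝ] ℝ).toLinearMap :=
        h ▸ Submodule.mem_top
      have h2 : (EuclideanSpace.single i (1 : ℝ)) i = 0 := h1
      simp at h2)
  exact h

end Coordinates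

/-! ### The planar region and its map onto the comb. -/

/-- The projection of the zero set of `eMap` to the first two coordinates. -/
def region : Set (ℝ × ℝ) := {d | 0 ≤ d.1 - c₀ d.2 ∧ 0 ≤ disk d.1 d.2}

theorem disk_add_sq (t x : ℝ) :
    disk t x + (t - 1 / (2 * π)) ^ 2 + (x - 1 / (2 * π)) ^ 2 = 1 / (2 * π ^ 2) := by
  rw [disk_eq]
  ring

theorem c₀_lt_of_disk {t x : ℝ} (hx : 1 / π < x) (h : 0 ≤ disk t x) : c₀ x < t := by
  refine (c₀_lt_of_inv_pi_lt hx).trans_le ?_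
  have h1 : π * (1 / π) = 1 := by field_simp
  have h2 : x * (x - 1 / π) ≤ t * (1 / π) := by
    have h3 : t * (1 / π) - x * (x - 1 / π) = disk t x + t ^ 2 := by
      unfold disk
      ring
    nlinarith
  calc π * x * (x - 1 / π) = π * (x * (x - 1 / π)) := by ring
    _ ≤ π * (t * (1 / π)) := by gcongr
    _ = t := by linear_combination t * h1

theorem pos_of_disk {t x : ℝ} (hx : x < 0) (h : 0 ≤ disk t x) : 0 < t := by
  have hpi : (0 : ℝ) < 1 / π := by positivity
  unfold disk at h
  by_contra ht
  nlinarith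

/-- For x < 0 or x > 1/π the disk inequality alone puts (t, x) beyond the graph, so only the part of
the graph over [0, 1/π] matters and `c₀` can be clamped there. -/
theorem mem_region_iff {t x : ℝ} :
    (t, x) ∈ region ↔ 0 ≤ disk t x ∧ 0 ≤ t ∧ c₀ (clampPi x) ≤ t := by
  show (0 ≤ t - c₀ x ∧ 0 ≤ disk t x) ↔ _
  have hpi : (0 : ℝ) < 1 / π := by positivity
  rw [and_comm, sub_nonneg]
  refine and_congr_right fun hd => ?_
  rcases lt_or_ge x 0 with hx | hx
  · have h1 := pos_of_disk hx hd
    have h2 := c₀_nonpos hx.le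
    have h3 : clampPi x = 0 := max_eq_left ((min_le_left _ _).trans hx.le)
    rw [h3, c₀_zero]
    exact ⟨fun _ => ⟨h1.le, h1.le⟩, fun _ => by linarith⟩
  rcases lt_or_ge (1 / π) x with hx1 | hx1
  · have h1 := c₀_lt_of_disk hx1 hd
    have h2 := c₀_nonneg hx
    have h3 : clampPi x = 1 / π := by rw [clampPi, min_eq_right hx1.le, max_eq_right hpi.le]
    rw [h3, ← zeroPt_zero, c₀_zeroPt]
    exact ⟨fun _ => ⟨by linarith, by linarith⟩, fun _ => h1.le⟩
  · rw [clampPi_of_mem ⟨hx, hx1⟩]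
    exact ⟨fun h => ⟨(c₀_nonneg hx).trans h, h⟩, fun h => h.2⟩

theorem disk_nonneg_of_mem {t x : ℝ} (ht : t ∈ Icc 0 (1 / π)) (hx : x ∈ Icc 0 (1 / π)) :
    0 ≤ disk t x :=
  add_nonneg (mul_nonneg ht.1 (sub_nonneg.2 ht.2)) (mul_nonneg hx.1 (sub_nonneg.2 hx.2))

/-- The ordinates of the vertices on the spine of the comb. -/
noncomputable def combHeight : ℕ → ℝ
  | 0 => 1 / (2 * π) + √(1 / (2 * π ^ 2))
  | k + 1 => c₀ (peak k)

theorem c₀_peak_le_half (k : ℕ) : c₀ (peak k) ≤ 1 / (2 * π) :=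
  c₀_le_half (peak_pos k).le ((peak_mem k).2.le.trans (zeroPt_le k))

theorem half_lt_combHeight : 1 / (2 * π) < combHeight 0 := by
  have : 0 < √(1 / (2 * π ^ 2)) := sqrt_pos.2 (by positivity)
  show 1 / (2 * π) < 1 / (2 * π) + √(1 / (2 * π ^ 2))
  linarith

theorem isCombSeq_combHeight : IsCombSeq combHeight where
  anti := by
    refine strictAnti_nat_of_succ_lt fun k => ?_
    cases k with
    | zero => exact (c₀_peak_le_half 0).trans_lt half_lt_combHeight
    | succ k => exact strictAnti_c₀_peak (Nat.lt_succ_self k)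
  pos := fun k => by
    cases k with
    | zero => exact lt_trans (by positivity) half_lt_combHeight
    | succ k => exact c₀_peak_pos k
  lim := (Filter.tendsto_add_atTop_iff_nat 1).1 tendsto_c₀_peak

theorem le_combHeight {t x : ℝ} (h : 0 ≤ disk t x) : t ≤ combHeight 0 := by
  have h1 := disk_add_sq t x
  have h2 := abs_le_sqrt (show (t - 1 / (2 * π)) ^ 2 ≤ 1 / (2 * π ^ 2) by nlinarith)
  have h3 := (le_abs_self _).trans h2
  show t ≤ 1 / (2 * π) + √(1 / (2 * π ^ 2))
  linarith

theorem disk_combHeight : disk (combHeight 0) (1 / (2 * π)) = 0 := by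
  have h1 := disk_add_sq (combHeight 0) (1 / (2 * π))
  have h2 : combHeight 0 - 1 / (2 * π) = √(1 / (2 * π ^ 2)) := add_sub_cancel_left _ _
  rw [h2, sq_sqrt (by positivity)] at h1
  linarith

/-- The map which sends a point of the region to the point of the comb which represents its
contour. -/
noncomputable def foldMap (d : ℝ × ℝ) : ℝ × ℝ := (d.1, max d.1 (runMax d.2))

theorem continuous_foldMap : Continuous foldMap := by
  have := continuous_runMax
  unfold foldMap
  fun_prop

theorem foldMap_mem {d : ℝ × ℝ} (hd : d ∈ region) : foldMap d ∈ combSet combHeight := by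
  obtain ⟨t, x⟩ := d
  obtain ⟨h1, h2, h3⟩ := mem_region_iff.1 hd
  refine ⟨h2, le_max_left _ _, max_le (le_combHeight h1)
    ((runMax_le_half x).trans half_lt_combHeight.le), ?_⟩
  show t = max t (runMax x) ∨ ∃ k, max t (runMax x) = c₀ (peak k)
  rcases le_or_gt (runMax x) t with h | h
  · exact Or.inl (max_eq_left h).symm
  · rw [max_eq_right h.le]
    exact Or.inr (exists_runMax_eq h2 h3 h)

theorem exists_foldMap_eq {g : ℝ × ℝ} (hg : g ∈ combSet combHeight) :
    ∃ d ∈ region, foldMap d = g := by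
  obtain ⟨t, u⟩ := g
  obtain ⟨h0, h1, h2, h3 | ⟨k, h3⟩⟩ := hg
  · simp only at h0 h1 h2 h3
    subst h3
    have hpi : (0 : ℝ) ≤ 1 / π := by positivity
    -- The spine is lifted along the chord x = 0, which leaves the disk at t = 1/π, and from there
    -- on along the diameter x = 1/(2π).
    rcases le_or_gt t (1 / π) with ht | ht
    · refine ⟨(t, 0), mem_region_iff.2 ⟨disk_nonneg_of_mem ⟨h0, ht⟩ ⟨le_rfl, hpi⟩, h0, ?_⟩, ?_⟩
      · rw [clampPi_of_mem ⟨le_rfl, hpi⟩, c₀_zero]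
        exact h0
      · rw [foldMap, runMax_of_nonpos le_rfl, max_eq_left h0]
    · have hlt : 1 / (2 * π) ≤ 1 / π :=
        one_div_le_one_div_of_le pi_pos (by linarith [pi_pos])
      have hmem : 1 / (2 * π) ∈ Icc 0 (1 / π) := ⟨by positivity, hlt⟩
      refine ⟨(t, 1 / (2 * π)), mem_region_iff.2 ⟨?_, h0, ?_⟩, ?_⟩
      · have h4 := disk_add_sq t (1 / (2 * π))
        have h5 : t - 1 / (2 * π) ≤ √(1 / (2 * π ^ 2)) := sub_le_iff_le_add'.2 h2
        have h6 : (t - 1 / (2 * π)) ^ 2 ≤ √(1 / (2 * π ^ 2)) ^ 2 := by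
          apply pow_le_pow_left₀ _ h5
          linarith
        rw [sq_sqrt (by positivity)] at h6
        linarith
      · rw [clampPi_of_mem hmem]
        exact (c₀_le_half hmem.1 hmem.2).trans (hlt.trans ht.le)
      · rw [foldMap, max_eq_left ((runMax_le_half _).trans (hlt.trans ht.le))]
  · have h4 : u = c₀ (peak k) := h3
    simp only at h0 h1
    subst h4
    have hlt : 1 / (2 * π) ≤ 1 / π :=
      one_div_le_one_div_of_le pi_pos (by linarith [pi_pos])
    -- A tooth is lifted over the bottom of the trough to the right of its peak.
    refine ⟨(t, zeroPt k), mem_region_iff.2 ⟨disk_nonneg_of_mem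
      ⟨h0, h1.trans ((c₀_peak_le_half k).trans hlt)⟩ ⟨(zeroPt_pos k).le, zeroPt_le k⟩, h0, ?_⟩, ?_⟩
    · rw [clampPi_of_mem ⟨(zeroPt_pos k).le, zeroPt_le k⟩, c₀_zeroPt]
      exact h0
    · rw [foldMap, runMax_zeroPt, max_eq_right h1]

theorem disk_nonneg_of_mem_Icc {t x y w : ℝ} (hx : 0 ≤ disk t x) (hy : 0 ≤ disk t y)
    (hw : w ∈ Icc x y) : 0 ≤ disk t w := by
  have h1 := disk_add_sq t x
  have h2 := disk_add_sq t y
  have h3 := disk_add_sq t w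
  have h4 := abs_le_max_abs_abs (sub_le_sub_right hw.1 (1 / (2 * π)))
    (sub_le_sub_right hw.2 (1 / (2 * π)))
  rcases le_max_iff.1 h4 with h5 | h5
  · have := sq_le_sq.2 h5
    linarith
  · have := sq_le_sq.2 h5
    linarith

theorem segment_subset_region {t x y : ℝ} (hxy : x ≤ y) (hx : (t, x) ∈ region)
    (hy : (t, y) ∈ region) (h : foldMap (t, x) = foldMap (t, y)) {w : ℝ} (hw : w ∈ Icc x y) :
    (t, w) ∈ region := by
  rw [mem_region_iff] at hx hy ⊢
  refine ⟨disk_nonneg_of_mem_Icc hx.1 hy.1 hw, hx.2.1, ?_⟩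
  exact c₀_le_of_max_runMax_eq hx.2.1 hxy hx.2.2 hy.2.2 (congrArg Prod.snd h) _
    ⟨monotone_clampPi hw.1, monotone_clampPi hw.2⟩

theorem foldMap_eq_of_segment {t x y : ℝ} (hxy : x ≤ y)
    (h : ∀ w ∈ Icc x y, (t, w) ∈ region) : foldMap (t, x) = foldMap (t, y) := by
  refine Prod.ext rfl (max_runMax_eq hxy fun w hw => ?_)
  have hc : clampPi w = w :=
    clampPi_of_mem ⟨(clampPi_mem x).1.trans hw.1, hw.2.trans (clampPi_mem y).2⟩
  have key : ∀ v ∈ Icc x y, c₀ (clampPi v) ≤ t := fun v hv => (mem_region_iff.1 (h v hv)).2.2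
  -- Clamping can leave [x, y]: w < x happens only if x > 1/π, and y < w only if y < 0. In both
  -- cases w is the clamped endpoint.
  rcases lt_or_ge w x with hwx | hwx
  · rw [le_antisymm (hc ▸ monotone_clampPi hwx.le) hw.1]
    exact key x ⟨le_rfl, hxy⟩
  rcases lt_or_ge y w with hwy | hwy
  · rw [le_antisymm hw.2 (hc ▸ monotone_clampPi hwy.le)]
    exact key y ⟨hxy, le_rfl⟩
  · rw [← hc]
    exact key w ⟨hwx, hwy⟩

theorem isCompact_region : IsCompact region := by
  have hc := contDiff_c₀.continuous
  have hd : Continuous fun d : ℝ × ℝ => disk d.1 d.2 := by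
    unfold disk
    fun_prop
  refine Metric.isCompact_of_isClosed_isBounded ?_ ?_
  · exact (isClosed_le continuous_const (continuous_fst.sub (hc.comp continuous_snd))).inter
      (isClosed_le continuous_const hd)
  · refine (Metric.isBounded_closedBall (x := ((1 / (2 * π) : ℝ), (1 / (2 * π) : ℝ)))
      (r := √(1 / (2 * π ^ 2)))).subset ?_
    rintro ⟨t, x⟩ ⟨-, h⟩
    have h1 := disk_add_sq t x
    simp only at h
    rw [Metric.mem_closedBall, Prod.dist_eq]
    refine max_le (abs_le_sqrt ?_) (abs_le_sqrt ?_) <;> simp only <;> nlinarith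

/-- Changing t towards 1/(2π) stays in the disk and beyond the clamped graph, whose height is at
most 1/(2π). The diameter reached in this way lies in the region and leads to the centre. -/
theorem isConnected_region : IsConnected region := by
  set p := 1 / (2 * π) with hp
  have hp0 : 0 ≤ p := by positivity
  have hbase : ∀ w, (w - p) ^ 2 ≤ 1 / (2 * π ^ 2) → (p, w) ∈ region := fun w hw => by
    have h1 := disk_add_sq p w
    rw [← hp, sub_self] at h1
    exact mem_region_iff.2 ⟨by linarith, hp0,
      c₀_le_half (clampPi_mem w).1 (clampPi_mem w).2⟩
  refine ⟨⟨(p, p), hbase p (by rw [sub_self, zero_pow two_ne_zero]; positivity)⟩,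
    isPreconnected_of_forall (p, p) ?_⟩
  rintro ⟨t, x⟩ hd
  obtain ⟨h1, h2, h3⟩ := mem_region_iff.1 hd
  have h4 := disk_add_sq t x
  rw [← hp] at h4
  refine ⟨(fun s : ℝ => (s, x)) '' uIcc t p ∪ (fun w : ℝ => (p, w)) '' uIcc p x, ?_, ?_, ?_, ?_⟩
  · rintro _ (⟨s, hs, rfl⟩ | ⟨w, hw, rfl⟩)
    · have h5 := disk_add_sq s x
      rw [← hp] at h5
      have h6 : (s - p) ^ 2 ≤ (t - p) ^ 2 := by
        rw [sq_le_sq, abs_sub_comm s p, abs_sub_comm t p]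
        exact abs_sub_right_of_mem_uIcc hs
      have h7 : c₀ (clampPi x) ≤ s :=
        (le_min h3 (c₀_le_half (clampPi_mem x).1 (clampPi_mem x).2)).trans hs.1
      exact mem_region_iff.2 ⟨by linarith, (c₀_nonneg (clampPi_mem x).1).trans h7, h7⟩
    · refine hbase w ?_
      have h6 : (w - p) ^ 2 ≤ (x - p) ^ 2 := by
        rw [sq_le_sq]
        exact abs_sub_left_of_mem_uIcc hw
      nlinarith
  · exact Or.inr ⟨p, left_mem_uIcc, rfl⟩
  · exact Or.inl ⟨t, left_mem_uIcc, rfl⟩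
  · refine IsPreconnected.union (p, x) ⟨p, right_mem_uIcc, rfl⟩ ⟨x, right_mem_uIcc, rfl⟩ ?_ ?_
    · exact isPreconnected_uIcc.image _ (by fun_prop)
    · exact isPreconnected_uIcc.image _ (by fun_prop)

/-! ### Contours and the Reeb space. -/

section Contours

variable {m₁ m₂ : ℕ}

variable (m₁ m₂) in
/-- The first two coordinates. -/
noncomputable def planePart (x : EuclideanSpace ℝ (Fin (m₁ + m₂ + 2))) : ℝ × ℝ :=
  ((coords m₁ m₂ x).1, (coords m₁ m₂ x).2.1)

theorem continuous_planePart : Continuous (planePart m₁ m₂) := by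
  unfold planePart
  fun_prop

theorem mem_oscManifold_iff {x : EuclideanSpace ℝ (Fin (m₁ + m₂ + 2))} : x ∈ oscManifold m₁ m₂ ↔
    (planePart m₁ m₂ x).1 - c₀ (planePart m₁ m₂ x).2 = ‖(coords m₁ m₂ x).2.2.1‖ ^ 2 ∧
    disk (planePart m₁ m₂ x).1 (planePart m₁ m₂ x).2 = ‖(coords m₁ m₂ x).2.2.2‖ ^ 2 := by
  rw [mem_oscManifold, leftFun, rightFun, sub_eq_zero, sub_eq_zero]
  rfl

theorem planePart_mem_region {x : EuclideanSpace ℝ (Fin (m₁ + m₂ + 2))}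
    (hx : x ∈ oscManifold m₁ m₂) : planePart m₁ m₂ x ∈ region := by
  obtain ⟨h1, h2⟩ := mem_oscManifold_iff.1 hx
  exact ⟨h1 ▸ sq_nonneg _, h2 ▸ sq_nonneg _⟩

variable (m₁ m₂) in
/-- The point of the zero set of `eMap` with given first coordinates and directions of `y`, `z`. -/
noncomputable def liftMap (p : (ℝ × ℝ) × EuclideanSpace ℝ (Fin m₁) × EuclideanSpace ℝ (Fin m₂)) :
    EuclideanSpace ℝ (Fin (m₁ + m₂ + 2)) :=
  (coords m₁ m₂).symm (p.1.1, p.1.2, √(p.1.1 - c₀ p.1.2) • p.2.1, √(disk p.1.1 p.1.2) • p.2.2)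

theorem continuous_liftMap : Continuous (liftMap m₁ m₂) := by
  have hc := contDiff_c₀.continuous
  unfold liftMap disk
  fun_prop

theorem exists_unit_smul {E : Type*} [NormedAddCommGroup E] [NormedSpace ℝ E] [Nontrivial E]
    (y : E) : ∃ v ∈ Metric.sphere (0 : E) 1, y = ‖y‖ • v := by
  by_cases hy : y = 0
  · obtain ⟨v, hv⟩ := (NormedSpace.sphere_nonempty (x := (0 : E)) (r := 1)).2 zero_le_one
    exact ⟨v, hv, by simp [hy]⟩
  · refine ⟨‖y‖⁻¹ • y, by simp [norm_smul, hy], ?_⟩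
    rw [smul_smul, mul_inv_cancel₀ (norm_ne_zero_iff.2 hy), one_smul]

variable (h₁ : 1 < m₁) (h₂ : 1 < m₂)

include h₁ in
theorem isConnected_unitSphere :
    IsConnected (Metric.sphere (0 : EuclideanSpace ℝ (Fin m₁)) 1) := by
  refine isConnected_sphere ?_ 0 zero_le_one
  rw [← Module.finrank_eq_rank, finrank_euclideanSpace_fin]
  exact_mod_cast h₁

section Lift

include h₁ h₂

/-- Polar coordinates in y and z: the equations prescribe only the norms, and where a norm is 0 any
direction will do. -/
theorem liftMap_image {K : Set (ℝ × ℝ)} (hK : K ⊆ region) : liftMap m₁ m₂ ''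
    (K ×ˢ Metric.sphere 0 1 ×ˢ Metric.sphere 0 1) =
      {x ∈ oscManifold m₁ m₂ | planePart m₁ m₂ x ∈ K} := by
  have : Nontrivial (EuclideanSpace ℝ (Fin m₁)) :=
    Module.nontrivial_of_finrank_pos (R := ℝ) (by rw [finrank_euclideanSpace_fin]; omega)
  have : Nontrivial (EuclideanSpace ℝ (Fin m₂)) :=
    Module.nontrivial_of_finrank_pos (R := ℝ) (by rw [finrank_euclideanSpace_fin]; omega)
  ext x
  constructor
  · rintro ⟨⟨⟨t, w⟩, y, z⟩, ⟨hd, hy, hz⟩, rfl⟩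
    simp only at hd
    rw [mem_sphere_zero_iff_norm] at hy hz
    obtain ⟨ha, hb⟩ := hK hd
    have hp : planePart m₁ m₂ (liftMap m₁ m₂ ((t, w), y, z)) = (t, w) := by
      simp [planePart, liftMap]
    refine ⟨mem_oscManifold_iff.2 ?_, by rw [hp]; exact hd⟩
    rw [hp, liftMap, ContinuousLinearEquiv.apply_symm_apply]
    simp only at ha hb hy hz ⊢
    rw [norm_smul, norm_smul, hy, hz, mul_one, mul_one, norm_eq_abs, norm_eq_abs, sq_abs, sq_abs,
      sq_sqrt ha, sq_sqrt hb]
    exact ⟨rfl, rfl⟩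
  · rintro ⟨hx, hd⟩
    obtain ⟨ha, hb⟩ := mem_oscManifold_iff.1 hx
    obtain ⟨v, hv, hyv⟩ := exists_unit_smul (coords m₁ m₂ x).2.2.1
    obtain ⟨w, hw, hzw⟩ := exists_unit_smul (coords m₁ m₂ x).2.2.2
    refine ⟨(planePart m₁ m₂ x, v, w), ⟨hd, hv, hw⟩, ?_⟩
    rw [liftMap]
    simp only
    rw [ha, hb, sqrt_sq (norm_nonneg _), sqrt_sq (norm_nonneg _), ← hyv, ← hzw]
    exact (coords m₁ m₂).symm_apply_apply x

theorem isPreconnected_over {K : Set (ℝ × ℝ)} (hK : K ⊆ region) (hc : IsPreconnected K) :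
    IsPreconnected {x ∈ oscManifold m₁ m₂ | planePart m₁ m₂ x ∈ K} := by
  rw [← liftMap_image h₁ h₂ hK]
  exact (hc.prod ((isConnected_unitSphere h₁).isPreconnected.prod
    (isConnected_unitSphere h₂).isPreconnected)).image _ continuous_liftMap.continuousOn

theorem liftMap_image_region : liftMap m₁ m₂ ''
    (region ×ˢ Metric.sphere 0 1 ×ˢ Metric.sphere 0 1) = oscManifold m₁ m₂ := by
  rw [liftMap_image h₁ h₂ Subset.rfl]
  exact Subset.antisymm (fun x hx => hx.1) fun x hx => ⟨hx, planePart_mem_region hx⟩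

theorem isCompact_oscManifold : IsCompact (oscManifold m₁ m₂) := by
  rw [← liftMap_image_region h₁ h₂]
  exact (isCompact_region.prod ((isCompact_sphere _ _).prod (isCompact_sphere _ _))).image
    continuous_liftMap

theorem isConnected_oscManifold : IsConnected (oscManifold m₁ m₂) := by
  rw [← liftMap_image_region h₁ h₂]
  exact (isConnected_region.prod ((isConnected_unitSphere h₁).prod
    (isConnected_unitSphere h₂))).image _ continuous_liftMap.continuousOn

theorem exists_planePart_eq {d : ℝ × ℝ} (hd : d ∈ region) :
    ∃ x ∈ oscManifold m₁ m₂, planePart m₁ m₂ x = d := by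
  obtain ⟨y, hy⟩ := (isConnected_unitSphere h₁).nonempty
  obtain ⟨z, hz⟩ := (isConnected_unitSphere h₂).nonempty
  have h : liftMap m₁ m₂ (d, y, z) ∈
      {x ∈ oscManifold m₁ m₂ | planePart m₁ m₂ x ∈ ({d} : Set _)} := by
    rw [← liftMap_image h₁ h₂ (singleton_subset_iff.2 hd)]
    exact mem_image_of_mem _ ⟨rfl, hy, hz⟩
  exact ⟨_, h.1, h.2⟩

end Lift

variable (m₁ m₂) in
/-- The function `cFun` for the parameters chosen here. -/
noncomputable abbrev oscHeight : oscManifold m₁ m₂ → ℝ :=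
  cFun (1 / (2 * π)) (1 / (2 * π)) 1 1 (1 / (2 * π ^ 2)) m₁ m₂

variable (m₁ m₂) in
/-- The map from the zero set of `eMap` to the comb which collapses the contours. -/
noncomputable def toComb (x : oscManifold m₁ m₂) : combSet combHeight :=
  ⟨foldMap (planePart m₁ m₂ x), foldMap_mem (planePart_mem_region x.2)⟩

theorem continuous_toComb : Continuous (toComb m₁ m₂) :=
  (continuous_foldMap.comp (continuous_planePart.comp continuous_subtype_val)).subtype_mk _

include h₁ h₂ in
theorem surjective_toComb : Function.Surjective (toComb m₁ m₂) := by
  rintro ⟨g, hg⟩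
  obtain ⟨d, hd, rfl⟩ := exists_foldMap_eq hg
  obtain ⟨x, hx, rfl⟩ := exists_planePart_eq h₁ h₂ hd
  exact ⟨⟨x, hx⟩, rfl⟩

/-- The x₂-coordinates of a contour form an interval at constant t, so the planar segment between
any two of its points lies in the region. -/
theorem toComb_eq_of_mem_contour {x y : oscManifold m₁ m₂}
    (h : y ∈ connectedComponentIn (oscHeight m₁ m₂ ⁻¹' {oscHeight m₁ m₂ x}) x) :
    toComb m₁ m₂ x = toComb m₁ m₂ y := by
  set C := connectedComponentIn (oscHeight m₁ m₂ ⁻¹' {oscHeight m₁ m₂ x}) x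
  have hx : x ∈ C := mem_connectedComponentIn rfl
  have hcont : Continuous fun z : oscManifold m₁ m₂ => (planePart m₁ m₂ z).2 :=
    continuous_snd.comp (continuous_planePart.comp continuous_subtype_val)
  have hpre : IsPreconnected ((fun z : oscManifold m₁ m₂ => (planePart m₁ m₂ z).2) '' C) :=
    isPreconnected_connectedComponentIn.image _ hcont.continuousOn
  have hC : ∀ z ∈ C, planePart m₁ m₂ z = ((planePart m₁ m₂ x).1, (planePart m₁ m₂ z).2) :=
    fun z hz => by
      have hz' : z ∈ oscHeight m₁ m₂ ⁻¹' {oscHeight m₁ m₂ x} :=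
        connectedComponentIn_subset _ _ hz
      have hz'' : oscHeight m₁ m₂ z = oscHeight m₁ m₂ x := hz'
      exact Prod.ext hz'' rfl
  have key : ∀ a ∈ C, ∀ b ∈ C, (planePart m₁ m₂ a).2 ≤ (planePart m₁ m₂ b).2 →
      foldMap (planePart m₁ m₂ a) = foldMap (planePart m₁ m₂ b) := by
    intro a ha b hb hab
    rw [hC a ha, hC b hb]
    refine foldMap_eq_of_segment hab fun w hw => ?_
    obtain ⟨z, hz, rfl⟩ := hpre.Icc_subset (mem_image_of_mem _ ha) (mem_image_of_mem _ hb) hw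
    rw [← hC z hz]
    exact planePart_mem_region z.2
  apply Subtype.ext
  rcases le_total (planePart m₁ m₂ x).2 (planePart m₁ m₂ y).2 with h' | h'
  · exact key x hx y h h'
  · exact (key y h x hx h').symm

-- Equal images force the segment between the two planar points into the region. The part of the
-- manifold over this segment is connected and lies in a single level set.
include h₁ h₂ in
theorem mem_contour_of_toComb_eq {x y : oscManifold m₁ m₂} (h : toComb m₁ m₂ x = toComb m₁ m₂ y) :
    y ∈ connectedComponentIn (oscHeight m₁ m₂ ⁻¹' {oscHeight m₁ m₂ x}) x := by
  have h' : foldMap (planePart m₁ m₂ x) = foldMap (planePart m₁ m₂ y) := congrArg Subtype.val h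
  have ht : (planePart m₁ m₂ y).1 = (planePart m₁ m₂ x).1 := (congrArg Prod.fst h').symm
  set t := (planePart m₁ m₂ x).1 with htdef
  have hpx : planePart m₁ m₂ x = (t, (planePart m₁ m₂ x).2) := rfl
  have hpy : planePart m₁ m₂ y = (t, (planePart m₁ m₂ y).2) := Prod.ext ht rfl
  have hrx := planePart_mem_region x.2
  have hry := planePart_mem_region y.2
  set K := (fun w : ℝ => (t, w)) '' uIcc (planePart m₁ m₂ x).2 (planePart m₁ m₂ y).2
  have hK : K ⊆ region := by
    rintro _ ⟨w, hw, rfl⟩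
    rcases le_total (planePart m₁ m₂ x).2 (planePart m₁ m₂ y).2 with h0 | h0
    · rw [uIcc_of_le h0] at hw
      exact segment_subset_region h0 (hpx ▸ hrx) (hpy ▸ hry) (by rw [← hpx, ← hpy]; exact h') hw
    · rw [uIcc_of_ge h0] at hw
      exact segment_subset_region h0 (hpy ▸ hry) (hpx ▸ hrx)
        (by rw [← hpx, ← hpy]; exact h'.symm) hw
  have hS := isPreconnected_over h₁ h₂ hK (isPreconnected_uIcc.image _ (by fun_prop))
  have hS' : IsPreconnected {z : oscManifold m₁ m₂ | planePart m₁ m₂ z ∈ K} := by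
    rw [← IsInducing.subtypeVal.isPreconnected_image]
    convert hS using 1
    ext z
    exact ⟨fun ⟨w, hw, hwz⟩ => hwz ▸ ⟨w.2, hw⟩, fun hz => ⟨⟨z, hz.1⟩, hz.2, rfl⟩⟩
  refine hS'.subset_connectedComponentIn ?_ ?_ ?_
  · exact ⟨_, left_mem_uIcc, rfl⟩
  · rintro z ⟨w, -, hw⟩
    exact (congrArg Prod.fst hw).symm
  · exact ⟨_, right_mem_uIcc, hpy.symm⟩

variable (m₁ m₂) in
/-- The map from the Reeb space to the comb. -/
noncomputable def reebToComb : ReebSpace (oscHeight m₁ m₂) → combSet combHeight :=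
  Quotient.lift (toComb m₁ m₂) fun _ _ h => toComb_eq_of_mem_contour h

/-- The Reeb space is homeomorphic to the comb. -/
noncomputable def reebHomeo : ReebSpace (oscHeight m₁ m₂) ≃ₜ combSet combHeight :=
  have : CompactSpace (oscManifold m₁ m₂) :=
    isCompact_iff_compactSpace.1 (isCompact_oscManifold h₁ h₂)
  Continuous.homeoOfEquivCompactToT2 (f := Equiv.ofBijective (reebToComb m₁ m₂) ⟨by
    rintro ⟨x⟩ ⟨y⟩ h
    exact Quotient.sound (mem_contour_of_toComb_eq h₁ h₂ h), fun g => by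
    obtain ⟨x, hx⟩ := surjective_toComb h₁ h₂ g
    exact ⟨reebMap _ x, hx⟩⟩) (continuous_toComb.quotient_lift _)

end Contours

/-! ### Regularity of the zero set and critical points of the height. -/

theorem mem_Icc_of_disk {t x : ℝ} (ht : t = c₀ x) (hd : 0 ≤ disk t x) :
    x ∈ Icc 0 (1 / π) ∧ t ∈ Icc 0 (1 / (2 * π)) := by
  have hx : x ∈ Icc 0 (1 / π) := by
    constructor
    · by_contra h
      rw [not_le] at h
      linarith [pos_of_disk h hd, c₀_nonpos h.le]
    · by_contra h
      rw [not_le] at h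
      linarith [c₀_lt_of_disk h hd]
  exact ⟨hx, ht ▸ c₀_nonneg hx.1, ht ▸ c₀_le_half hx.1 hx.2⟩

theorem half_lt_inv_pi : 1 / (2 * π) < 1 / π :=
  one_div_lt_one_div_of_lt pi_pos (by linarith [pi_pos])

/-- Both summands of `disk` are nonnegative on this part of the graph, so both vanish, and t ≤
1/(2π) excludes t = 1/π. These corners are the only places where y and z can vanish together. -/
theorem eq_corner {t x : ℝ} (ht : t = c₀ x) (hd : disk t x = 0) :
    t = 0 ∧ (x = 0 ∨ x = 1 / π) := by
  obtain ⟨hx, ht'⟩ := mem_Icc_of_disk ht hd.ge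
  have h1 : 0 < 1 / π - t := by linarith [half_lt_inv_pi, ht'.2]
  have h2 : 0 ≤ x * (1 / π - x) := mul_nonneg hx.1 (sub_nonneg.2 hx.2)
  have h3 : 0 ≤ t * (1 / π - t) := mul_nonneg ht'.1 h1.le
  unfold disk at hd
  have h4 : t * (1 / π - t) = 0 := by linarith
  have h5 : x * (1 / π - x) = 0 := by linarith
  refine ⟨(mul_eq_zero.1 h4).resolve_right h1.ne', ?_⟩
  rcases mul_eq_zero.1 h5 with h | h
  · exact Or.inl h
  · exact Or.inr (by linarith)

theorem deriv_c₀_corner {x : ℝ} (h : x = 0 ∨ x = 1 / π) : deriv c₀ x = 0 := by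
  rcases h with rfl | rfl
  · exact deriv_c₀_zero
  · rw [← zeroPt_zero]
    exact deriv_c₀_zeroPt 0

section Derivatives

variable {m₁ m₂ : ℕ}
  {γ : ℝ → ℝ × ℝ × EuclideanSpace ℝ (Fin m₁) × EuclideanSpace ℝ (Fin m₂)}
  {w : ℝ × ℝ × EuclideanSpace ℝ (Fin m₁) × EuclideanSpace ℝ (Fin m₂)} {s : ℝ}

theorem hasDerivAt_components (h : HasDerivAt γ w s) :
    HasDerivAt (fun s => (γ s).1) w.1 s ∧ HasDerivAt (fun s => (γ s).2.1) w.2.1 s ∧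
    HasDerivAt (fun s => (γ s).2.2.1) w.2.2.1 s ∧ HasDerivAt (fun s => (γ s).2.2.2) w.2.2.2 s := by
  have h' := hasFDerivAt_snd.comp_hasDerivAt s h
  have h'' := hasFDerivAt_snd.comp_hasDerivAt s h'
  have h1 := hasFDerivAt_fst.comp_hasDerivAt s h
  have h2 := hasFDerivAt_fst.comp_hasDerivAt s h'
  have h3 := hasFDerivAt_fst.comp_hasDerivAt s h''
  have h4 := hasFDerivAt_snd.comp_hasDerivAt s h''
  exact ⟨h1, h2, h3, h4⟩

theorem hasDerivAt_leftFun (h : HasDerivAt γ w s) : HasDerivAt (fun s => leftFun (γ s))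
    (w.1 - deriv c₀ (γ s).2.1 * w.2.1 - 2 * inner ℝ (γ s).2.2.1 w.2.2.1) s := by
  obtain ⟨h1, h2, h3, -⟩ := hasDerivAt_components h
  exact (h1.sub ((differentiable_c₀ _).hasDerivAt.comp s h2)).sub h3.norm_sq

theorem hasDerivAt_rightFun (h : HasDerivAt γ w s) : HasDerivAt (fun s => rightFun (γ s))
    ((1 / π - 2 * (γ s).1) * w.1 + (1 / π - 2 * (γ s).2.1) * w.2.1 -
      2 * inner ℝ (γ s).2.2.2 w.2.2.2) s := by
  obtain ⟨h1, h2, -, h4⟩ := hasDerivAt_components h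
  have h5 := (h1.mul (h1.const_sub (1 / π))).add (h2.mul (h2.const_sub (1 / π)))
  refine ((h5.sub h4.norm_sq).congr_deriv ?_)
  ring

/-- The linearization of the equations of the zero set of `eMap`. -/
theorem fderiv_oscMap (x v : EuclideanSpace ℝ (Fin (m₁ + m₂ + 2))) :
    fderiv ℝ (oscMap m₁ m₂) x v = !₂[
      (coords m₁ m₂ v).1 - deriv c₀ (coords m₁ m₂ x).2.1 * (coords m₁ m₂ v).2.1 -
        2 * inner ℝ (coords m₁ m₂ x).2.2.1 (coords m₁ m₂ v).2.2.1,
      (1 / π - 2 * (coords m₁ m₂ x).1) * (coords m₁ m₂ v).1 +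
        (1 / π - 2 * (coords m₁ m₂ x).2.1) * (coords m₁ m₂ v).2.1 -
        2 * inner ℝ (coords m₁ m₂ x).2.2.2 (coords m₁ m₂ v).2.2.2] := by
  have h1 : HasDerivAt (fun s : ℝ => x + s • v) v 0 := by
    simpa using ((hasDerivAt_id (0 : ℝ)).smul_const v).const_add x
  have h2 : HasDerivAt (fun s : ℝ => coords m₁ m₂ (x + s • v)) (coords m₁ m₂ v) 0 :=
    (coords m₁ m₂).hasFDerivAt.comp_hasDerivAt 0 h1
  have h3 : HasDerivAt (fun s : ℝ => oscMap m₁ m₂ (x + s • v)) (fderiv ℝ (oscMap m₁ m₂) x v) 0 := by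
    have h := (contDiff_oscMap.differentiable (by simp) (x + (0 : ℝ) • v)).hasFDerivAt
    have h' := h.comp_hasDerivAt 0 h1
    rw [zero_smul, add_zero] at h'
    exact h'
  have h4 : ∀ i, HasDerivAt (fun s : ℝ => oscMap m₁ m₂ (x + s • v) i)
      (fderiv ℝ (oscMap m₁ m₂) x v i) 0 := fun i =>
    (EuclideanSpace.proj (𝕜 := ℝ) i : EuclideanSpace ℝ (Fin 2) →L[ℝ] ℝ).hasFDerivAt.comp_hasDerivAt
      0 h3
  have h5 := hasDerivAt_leftFun h2
  have h6 := hasDerivAt_rightFun h2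
  simp only [zero_smul, add_zero] at h5 h6
  ext i
  fin_cases i
  · refine (h4 0).unique (h5.congr_of_eventuallyEq (Filter.Eventually.of_forall fun s => ?_))
    exact congrArg (fun u : EuclideanSpace ℝ (Fin 2) => u 0) (oscMap_eq (x + s • v))
  · refine (h4 1).unique (h6.congr_of_eventuallyEq (Filter.Eventually.of_forall fun s => ?_))
    exact congrArg (fun u : EuclideanSpace ℝ (Fin 2) => u 1) (oscMap_eq (x + s • v))

/-- If z ≠ 0, varying z solves the second equation once x₁ has solved the first. If z = 0 and y ≠ 0,
the gradient of `disk` is nonzero on the circle and y corrects the first equation. At a corner the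
derivative of `c₀` is 0 while that of `disk` in x₂ is not, so graph and circle are transverse. -/
theorem surjective_fderiv_oscMap {x : EuclideanSpace ℝ (Fin (m₁ + m₂ + 2))}
    (hx : x ∈ oscManifold m₁ m₂) : Function.Surjective (fderiv ℝ (oscMap m₁ m₂) x) := by
  obtain ⟨hl, hr⟩ := mem_oscManifold_iff.1 hx
  suffices h : ∀ a b : ℝ, ∃ w : ℝ × ℝ × EuclideanSpace ℝ (Fin m₁) × EuclideanSpace ℝ (Fin m₂),
      w.1 - deriv c₀ (coords m₁ m₂ x).2.1 * w.2.1 -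
        2 * inner ℝ (coords m₁ m₂ x).2.2.1 w.2.2.1 = a ∧
      (1 / π - 2 * (coords m₁ m₂ x).1) * w.1 + (1 / π - 2 * (coords m₁ m₂ x).2.1) * w.2.1 -
        2 * inner ℝ (coords m₁ m₂ x).2.2.2 w.2.2.2 = b by
    intro u
    obtain ⟨w, h1, h2⟩ := h (u 0) (u 1)
    refine ⟨(coords m₁ m₂).symm w, ?_⟩
    rw [fderiv_oscMap, ContinuousLinearEquiv.apply_symm_apply, h1, h2]
    ext i
    fin_cases i <;> rfl
  intro a b
  simp only [planePart] at hl hr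
  set t := (coords m₁ m₂ x).1
  set r := (coords m₁ m₂ x).2.1
  set y := (coords m₁ m₂ x).2.2.1
  set z := (coords m₁ m₂ x).2.2.2
  by_cases hz : z = 0
  · have hd : disk t r = 0 := by rw [hr, hz]; simp
    have hsum := disk_add_sq t r
    by_cases hy : y = 0
    · have ht : t = c₀ r := by
        rw [← sub_eq_zero, hl, hy]
        simp
      obtain ⟨ht0, hr0⟩ := eq_corner ht hd
      have hne : 1 / π - 2 * r ≠ 0 := by
        have : (0 : ℝ) < 1 / π := by positivity
        rcases hr0 with h | h <;> rw [h]
        · linarith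
        · intro h
          linarith
      refine ⟨(a, (b - (1 / π - 2 * t) * a) / (1 / π - 2 * r), 0, 0), ?_, ?_⟩
      · simp [deriv_c₀_corner hr0]
      · simp only [inner_zero_right]
        rw [mul_div_cancel₀ _ hne]
        ring
    · have hy' : ‖y‖ ^ 2 ≠ 0 := by simpa using hy
      have hne : (1 / π - 2 * t) ^ 2 + (1 / π - 2 * r) ^ 2 ≠ 0 := by
        have h1 : (1 / π - 2 * t) ^ 2 + (1 / π - 2 * r) ^ 2 =
            4 * ((t - 1 / (2 * π)) ^ 2 + (r - 1 / (2 * π)) ^ 2) := by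
          field_simp
          ring
        have h2 : (t - 1 / (2 * π)) ^ 2 + (r - 1 / (2 * π)) ^ 2 = 1 / (2 * π ^ 2) := by linarith
        rw [h1, h2]
        positivity
      set A := 1 / π - 2 * t
      set B := 1 / π - 2 * r
      set c := b / (A ^ 2 + B ^ 2)
      refine ⟨(c * A, c * B, ((c * A - deriv c₀ r * (c * B) - a) / (2 * ‖y‖ ^ 2)) • y, 0), ?_, ?_⟩
      · simp only [inner_smul_right, real_inner_self_eq_norm_sq]
        field_simp
        ring
      · simp only [inner_zero_right]
        have : c * (A ^ 2 + B ^ 2) = b := div_mul_cancel₀ _ hne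
        linear_combination this
  · have hz' : ‖z‖ ^ 2 ≠ 0 := by simpa using hz
    refine ⟨(a, 0, 0, (((1 / π - 2 * t) * a - b) / (2 * ‖z‖ ^ 2)) • z), ?_, ?_⟩
    · simp
    · simp only [inner_smul_right, real_inner_self_eq_norm_sq]
      field_simp
      ring

variable (m₁ m₂) in
theorem isSmoothSubmanifold_oscManifold : IsSmoothSubmanifold (m₁ + m₂) (oscManifold m₁ m₂) :=
  isSmoothSubmanifold_preimage_zero rfl contDiff_oscMap fun _ hx => surjective_fderiv_oscMap hx

/-- A positive multiple of a vector with prescribed norm. -/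
theorem exists_curve_norm_sq {E : Type*} [NormedAddCommGroup E] [InnerProductSpace ℝ E] (y : E)
    {A : ℝ → ℝ} (hA : ContDiffAt ℝ ∞ A 0) (h0 : A 0 = ‖y‖ ^ 2) (h : y ≠ 0 ∨ ∀ s, A s = 0) :
    ∃ η : ℝ → E, ContDiffAt ℝ ∞ η 0 ∧ η 0 = y ∧ ∀ᶠ s in 𝓝 0, ‖η s‖ ^ 2 = A s := by
  by_cases hy : y = 0
  · have hA0 := h.resolve_left (not_not.2 hy)
    exact ⟨fun _ => y, contDiffAt_const, rfl, Filter.Eventually.of_forall fun s => by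
      simp [hy, hA0]⟩
  · have hpos : 0 < ‖y‖ ^ 2 := by positivity
    have h1 : A 0 / ‖y‖ ^ 2 = 1 := by rw [h0, div_self hpos.ne']
    refine ⟨fun s => √(A s / ‖y‖ ^ 2) • y, ?_, ?_, ?_⟩
    · exact ((hA.div_const _).sqrt (by rw [h1]; exact one_ne_zero)).smul contDiffAt_const
    · simp only [h1, sqrt_one, one_smul]
    · have hev : ∀ᶠ s in 𝓝 0, 0 < A s :=
        hA.continuousAt.eventually (lt_mem_nhds (by rw [h0]; exact hpos))
      filter_upwards [hev] with s hs
      rw [norm_smul, mul_pow, norm_eq_abs, sq_abs, sq_sqrt (by positivity),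
        div_mul_cancel₀ _ (ne_of_gt hpos)]

/-- A planar curve lifts to a curve in the zero set of `eMap`, so that its velocity gives a
tangent vector. -/
theorem not_isCriticalPointOn_of_curve {x : EuclideanSpace ℝ (Fin (m₁ + m₂ + 2))}
    (hx : x ∈ oscManifold m₁ m₂) {δ₁ δ₂ : ℝ → ℝ} (h₁ : ContDiff ℝ ∞ δ₁) (h₂ : ContDiff ℝ ∞ δ₂)
    (e₁ : δ₁ 0 = (coords m₁ m₂ x).1) (e₂ : δ₂ 0 = (coords m₁ m₂ x).2.1)
    (hy : (coords m₁ m₂ x).2.2.1 ≠ 0 ∨ ∀ s, δ₁ s - c₀ (δ₂ s) = 0)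
    (hz : (coords m₁ m₂ x).2.2.2 ≠ 0 ∨ ∀ s, disk (δ₁ s) (δ₂ s) = 0) (hd : deriv δ₁ 0 ≠ 0) :
    ¬ IsCriticalPointOn (oscManifold m₁ m₂) (fun y => y 0) x := by
  rintro ⟨-, hcrit⟩
  obtain ⟨hl, hr⟩ := mem_oscManifold_iff.1 hx
  simp only [planePart, ← e₁, ← e₂] at hl hr
  have hA : ContDiff ℝ ∞ fun s => δ₁ s - c₀ (δ₂ s) := h₁.sub (contDiff_c₀.comp h₂)
  have hB : ContDiff ℝ ∞ fun s => disk (δ₁ s) (δ₂ s) := by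
    unfold disk
    fun_prop
  obtain ⟨η, hη, hη0, hηA⟩ := exists_curve_norm_sq _ hA.contDiffAt hl hy
  obtain ⟨ζ, hζ, hζ0, hζB⟩ := exists_curve_norm_sq _ hB.contDiffAt hr hz
  let γ : ℝ → EuclideanSpace ℝ (Fin (m₁ + m₂ + 2)) := fun s =>
    (coords m₁ m₂).symm (δ₁ s, δ₂ s, η s, ζ s)
  have hγ : ContDiffAt ℝ ∞ γ 0 :=
    (coords m₁ m₂).symm.contDiff.contDiffAt.comp 0
      (h₁.contDiffAt.prodMk (h₂.contDiffAt.prodMk (hη.prodMk hζ)))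
  have hγ' : HasDerivAt γ (deriv γ 0) 0 := (hγ.differentiableAt (by simp)).hasDerivAt
  have hmem : ∀ᶠ s in 𝓝 0, γ s ∈ oscManifold m₁ m₂ := by
    filter_upwards [hηA, hζB] with s h3 h4
    rw [mem_oscManifold_iff, planePart]
    simp only [γ, ContinuousLinearEquiv.apply_symm_apply]
    exact ⟨h3.symm, h4.symm⟩
  have hγ0 : γ 0 = x := by
    simp only [γ, hη0, hζ0, e₁, e₂]
    exact (coords m₁ m₂).symm_apply_apply x
  have h := hcrit (deriv γ 0) ⟨γ, hγ, hmem, hγ0, hγ'⟩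
  have hproj : HasFDerivAt (fun y : EuclideanSpace ℝ (Fin (m₁ + m₂ + 2)) => y 0)
      (EuclideanSpace.proj (𝕜 := ℝ) 0) x := (EuclideanSpace.proj (𝕜 := ℝ) 0).hasFDerivAt
  rw [hproj.fderiv] at h
  have hproj' := (EuclideanSpace.proj (𝕜 := ℝ) (0 : Fin (m₁ + m₂ + 2)) :
    EuclideanSpace ℝ (Fin (m₁ + m₂ + 2)) →L[ℝ] ℝ).hasFDerivAt.comp_hasDerivAt 0 hγ'
  rw [h] at hproj'
  refine hd ?_
  exact hproj'.deriv

/-- A noncritical point carries a curve along which x₁ has nonzero velocity: along the graph if y =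
0, around the circle if z = 0, and straight in x₁ if neither vanishes. Conversely, the linearized
equations annihilate the x₁-component of each tangent vector. -/
theorem isCriticalPointOn_iff {x : EuclideanSpace ℝ (Fin (m₁ + m₂ + 2))}
    (hx : x ∈ oscManifold m₁ m₂) : IsCriticalPointOn (oscManifold m₁ m₂) (fun y => y 0) x ↔
    ((coords m₁ m₂ x).2.2.1 = 0 ∧ deriv c₀ (coords m₁ m₂ x).2.1 = 0) ∨
    ((coords m₁ m₂ x).2.2.2 = 0 ∧ (coords m₁ m₂ x).2.1 = 1 / (2 * π)) := by
  obtain ⟨hl, hr⟩ := mem_oscManifold_iff.1 hx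
  simp only [planePart] at hl hr
  constructor
  · intro hcrit
    by_contra hne
    obtain ⟨hn1, hn2⟩ := not_or.1 hne
    rw [not_and] at hn1 hn2
    by_cases hy : (coords m₁ m₂ x).2.2.1 = 0
    · have ht : (coords m₁ m₂ x).1 = c₀ (coords m₁ m₂ x).2.1 := by
        rw [← sub_eq_zero, hl, hy]
        simp
      have hz : (coords m₁ m₂ x).2.2.2 ≠ 0 := by
        intro hz
        have hd : disk (coords m₁ m₂ x).1 (coords m₁ m₂ x).2.1 = 0 := by
          rw [hr, hz]
          simp
        exact hn1 hy (deriv_c₀_corner (eq_corner ht hd).2)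
      have hs : ContDiff ℝ ∞ fun s : ℝ => (coords m₁ m₂ x).2.1 + s := by fun_prop
      refine not_isCriticalPointOn_of_curve hx (contDiff_c₀.comp hs) hs ?_ (add_zero _)
        (Or.inr fun s => sub_self _) (Or.inl hz) ?_ hcrit
      · simp only [Function.comp_apply, add_zero, ht]
      · have hd : HasDerivAt (fun s : ℝ => (coords m₁ m₂ x).2.1 + s) 1 0 :=
          (hasDerivAt_id _).const_add _
        have hd' := (differentiable_c₀ ((coords m₁ m₂ x).2.1 + 0)).hasDerivAt.comp 0 hd
        rw [hd'.deriv, add_zero, mul_one]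
        exact hn1 hy
    · by_cases hz : (coords m₁ m₂ x).2.2.2 = 0
      · have hd : disk (coords m₁ m₂ x).1 (coords m₁ m₂ x).2.1 = 0 := by
          rw [hr, hz]
          simp
        have hr' := hn2 hz
        set t := (coords m₁ m₂ x).1
        set r := (coords m₁ m₂ x).2.1
        set p := 1 / (2 * π) with hp
        -- Rotation about the centre (p, p) of the disk; its initial x₁-velocity is −(r − p).
        refine not_isCriticalPointOn_of_curve (δ₁ := fun s => p + (t - p) * cos s - (r - p) * sin s)
          (δ₂ := fun s => p + (t - p) * sin s + (r - p) * cos s) hx (by fun_prop) (by fun_prop)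
          ?_ ?_ (Or.inl hy) (Or.inr fun s => ?_) ?_ hcrit
        · simp only [cos_zero, sin_zero]
          ring
        · simp only [cos_zero, sin_zero]
          ring
        · have h1 := disk_add_sq (p + (t - p) * cos s - (r - p) * sin s)
            (p + (t - p) * sin s + (r - p) * cos s)
          have h2 := disk_add_sq t r
          rw [← hp] at h1 h2
          linear_combination h1 - h2 + hd -
            ((t - p) ^ 2 + (r - p) ^ 2) * sin_sq_add_cos_sq s
        · have h1 : HasDerivAt (fun s => p + (t - p) * cos s - (r - p) * sin s)
              ((t - p) * -sin 0 - (r - p) * cos 0) 0 :=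
            (((hasDerivAt_cos 0).const_mul _).const_add p).sub ((hasDerivAt_sin 0).const_mul _)
          rw [h1.deriv, sin_zero, cos_zero]
          intro h
          exact hr' (by linarith)
      · refine not_isCriticalPointOn_of_curve (δ₁ := fun s => (coords m₁ m₂ x).1 + s)
          (δ₂ := fun s => (coords m₁ m₂ x).2.1) hx (by fun_prop) contDiff_const (add_zero _) rfl
          (Or.inl hy) (Or.inl hz) ?_ hcrit
        have hd : HasDerivAt (fun s : ℝ => (coords m₁ m₂ x).1 + s) 1 0 :=
          (hasDerivAt_id _).const_add _
        rw [hd.deriv]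
        exact one_ne_zero
  · intro h
    refine ⟨hx, ?_⟩
    rintro v ⟨γ, -, hmem, hγ0, hγ⟩
    have hproj : HasFDerivAt (fun y : EuclideanSpace ℝ (Fin (m₁ + m₂ + 2)) => y 0)
      (EuclideanSpace.proj (𝕜 := ℝ) 0) x := (EuclideanSpace.proj (𝕜 := ℝ) 0).hasFDerivAt
    rw [hproj.fderiv]
    show (coords m₁ m₂ v).1 = 0
    have h2 : HasDerivAt (fun s : ℝ => coords m₁ m₂ (γ s)) (coords m₁ m₂ v) 0 :=
      (coords m₁ m₂).hasFDerivAt.comp_hasDerivAt 0 hγ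
    have h3 := hasDerivAt_leftFun h2
    have h4 := hasDerivAt_rightFun h2
    simp only [hγ0] at h3 h4
    have h5 := h3.unique ((hasDerivAt_const (0 : ℝ) (0 : ℝ)).congr_of_eventuallyEq (by
      filter_upwards [hmem] with s hs using (mem_oscManifold.1 hs).1))
    have h6 := h4.unique ((hasDerivAt_const (0 : ℝ) (0 : ℝ)).congr_of_eventuallyEq (by
      filter_upwards [hmem] with s hs using (mem_oscManifold.1 hs).2))
    rcases h with ⟨hy, hd⟩ | ⟨hz, hp⟩
    · rw [hy, hd, inner_zero_left] at h5
      linarith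
    · have hd : disk (coords m₁ m₂ x).1 (coords m₁ m₂ x).2.1 = 0 := by
        rw [hr, hz]
        simp
      have h7 : 1 / π - 2 * (1 / (2 * π)) = 0 := by
        field_simp
        ring
      rw [hz, inner_zero_left, hp, h7] at h6
      have h8 : (1 / π - 2 * (coords m₁ m₂ x).1) * (coords m₁ m₂ v).1 = 0 := by linarith
      -- The other factor vanishes only at the centre of the disk, which is not on the circle.
      refine (mul_eq_zero.1 h8).resolve_left fun h9 => ?_
      have h10 := disk_add_sq (coords m₁ m₂ x).1 (coords m₁ m₂ x).2.1
      have h11 : (coords m₁ m₂ x).1 = 1 / (2 * π) := by linarith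
      rw [hd, hp, h11, sub_self] at h10
      have h12 : (0 : ℝ) < 1 / (2 * π ^ 2) := by positivity
      rw [← h10] at h12
      simp at h12

end Derivatives

/-! ### Matching critical contours with the vertices of the comb. -/

section Vertices

variable {m₁ m₂ : ℕ}

theorem foldMap_zero : foldMap (0, 0) = (0, 0) := by
  rw [foldMap, runMax_of_nonpos le_rfl, max_self]

theorem foldMap_zeroPt (k : ℕ) : foldMap (0, zeroPt k) = (0, combHeight (k + 1)) := by
  rw [foldMap, runMax_zeroPt, max_eq_right (c₀_peak_pos k).le]
  rfl

theorem foldMap_peak (k : ℕ) :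
    foldMap (c₀ (peak k), peak k) = (combHeight (k + 1), combHeight (k + 1)) := by
  rw [foldMap, runMax_peak, max_self]
  rfl

theorem foldMap_top :
    foldMap (combHeight 0, 1 / (2 * π)) = (combHeight 0, combHeight 0) := by
  rw [foldMap, max_eq_left ((runMax_le_half _).trans half_lt_combHeight.le)]

/-- Each x > 0 has a whole hump to its left and hence a positive running maximum, while x < 0
requires t > 0 in the disk. So the contour of the origin is a single point. -/
theorem eq_zero_of_foldMap_eq {t r : ℝ} (hd : (t, r) ∈ region) (h : foldMap (t, r) = (0, 0)) :
    t = 0 ∧ r = 0 := by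
  obtain ⟨rfl, h2⟩ := Prod.mk.inj h
  refine ⟨rfl, ?_⟩
  simp only at h2
  have hmax : runMax r ≤ 0 := (le_max_right _ _).trans h2.le
  by_contra hr
  rcases lt_or_gt_of_ne hr with hr | hr
  · exact lt_irrefl _ (pos_of_disk hr hd.2)
  · obtain ⟨k, hk⟩ := (tendsto_zeroPt.eventually (gt_mem_nhds hr)).exists
    have h3 := monotone_runMax (le_of_lt hk)
    rw [runMax_zeroPt] at h3
    linarith [c₀_peak_pos k]

theorem disk_zero : disk 0 0 = 0 := by simp [disk]

variable (m₁ m₂) in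
theorem zero_mem_oscManifold : (0 : EuclideanSpace ℝ (Fin (m₁ + m₂ + 2))) ∈ oscManifold m₁ m₂ := by
  rw [mem_oscManifold_iff]
  simp [planePart, c₀_zero, disk_zero]

theorem toComb_eq_tip_iff (x : oscManifold m₁ m₂) :
    toComb m₁ m₂ x = isCombSeq_combHeight.tip ↔ (x : EuclideanSpace ℝ (Fin (m₁ + m₂ + 2))) = 0 := by
  obtain ⟨hl, hr⟩ := mem_oscManifold_iff.1 x.2
  constructor
  · intro h
    obtain ⟨h1, h2⟩ := eq_zero_of_foldMap_eq (planePart_mem_region x.2) (congrArg Subtype.val h)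
    change (planePart m₁ m₂ x).1 = 0 at h1
    change (planePart m₁ m₂ x).2 = 0 at h2
    rw [h1, h2, c₀_zero, sub_zero, eq_comm, sq_eq_zero_iff, norm_eq_zero] at hl
    rw [h1, h2, disk_zero, eq_comm, sq_eq_zero_iff, norm_eq_zero] at hr
    refine (coords m₁ m₂).map_eq_zero_iff.1 ?_
    exact Prod.ext h1 (Prod.ext h2 (Prod.ext hl hr))
  · intro h
    apply Subtype.ext
    show foldMap (planePart m₁ m₂ x) = (0, 0)
    rw [← foldMap_zero, planePart, h, map_zero]
    rfl

/-- The other end of this diameter has t < 0. -/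
theorem eq_combHeight_of_disk_eq_zero {t : ℝ} (ht : 0 ≤ t) (h : disk t (1 / (2 * π)) = 0) :
    t = combHeight 0 := by
  have h1 := disk_add_sq t (1 / (2 * π))
  have h2 := disk_add_sq (combHeight 0) (1 / (2 * π))
  rw [disk_combHeight] at h2
  rw [h] at h1
  have h3 : (t - 1 / (2 * π)) ^ 2 = (combHeight 0 - 1 / (2 * π)) ^ 2 := by linarith
  rcases sq_eq_sq_iff_eq_or_eq_neg.1 h3 with h4 | h4
  · linarith
  · have h5 : combHeight 0 - 1 / (2 * π) = √(1 / (2 * π ^ 2)) := add_sub_cancel_left _ _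
    have h6 : 1 / (2 * π) < √(1 / (2 * π ^ 2)) := by
      apply lt_sqrt_of_sq_lt
      rw [div_pow, one_pow]
      apply one_div_lt_one_div_of_lt (by positivity)
      nlinarith [pi_pos]
    linarith

/-- A critical point other than the origin represents a vertex of the comb. -/
theorem toComb_mem_vertexSet {x : oscManifold m₁ m₂}
    (hne : toComb m₁ m₂ x ≠ isCombSeq_combHeight.tip)
    (hc : IsCriticalPointOn (oscManifold m₁ m₂) (fun y => y 0) x) :
    (⟨toComb m₁ m₂ x, hne⟩ : {g // g ≠ isCombSeq_combHeight.tip}) ∈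
      isCombSeq_combHeight.vertexSet := by
  have hreg := planePart_mem_region x.2
  obtain ⟨hl, hr⟩ := mem_oscManifold_iff.1 x.2
  have hp : planePart m₁ m₂ x = ((planePart m₁ m₂ x).1, (planePart m₁ m₂ x).2) := rfl
  rcases (isCriticalPointOn_iff x.2).1 hc with ⟨hy, hd⟩ | ⟨hz, hr'⟩
  · rw [hy, norm_zero, zero_pow two_ne_zero, sub_eq_zero] at hl
    have hmem := (mem_Icc_of_disk hl hreg.2).1
    replace hd : deriv c₀ (planePart m₁ m₂ x).2 = 0 := hd
    rcases hmem.1.eq_or_lt with h0 | h0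
    · rw [hl, ← h0, c₀_zero] at hp
      refine absurd (Subtype.ext ?_) hne
      show foldMap (planePart m₁ m₂ x) = (0, 0)
      rw [hp, foldMap_zero]
    · rcases eq_zeroPt_or_eq_peak h0 hmem.2 hd with ⟨k, hk⟩ | ⟨k, hk⟩
      · rw [hl, hk, c₀_zeroPt] at hp
        refine Or.inr ⟨k, ?_⟩
        show foldMap (planePart m₁ m₂ x) = _
        rw [hp, foldMap_zeroPt]
      · rw [hl, hk] at hp
        refine Or.inl ⟨k + 1, ?_⟩
        show foldMap (planePart m₁ m₂ x) = _
        rw [hp, foldMap_peak]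
  · replace hr' : (planePart m₁ m₂ x).2 = 1 / (2 * π) := hr'
    rw [hz, norm_zero, zero_pow two_ne_zero, hr'] at hr
    have ht : (planePart m₁ m₂ x).1 = combHeight 0 :=
      eq_combHeight_of_disk_eq_zero (mem_region_iff.1 hreg).2.1 hr
    rw [ht, hr'] at hp
    refine Or.inl ⟨0, ?_⟩
    show foldMap (planePart m₁ m₂ x) = _
    rw [hp, foldMap_top]

/-- Each vertex of the comb is represented by a critical point. -/
theorem exists_critical_of_mem_vertexSet (h₁ : 1 < m₁) (h₂ : 1 < m₂)
    {g : {g // g ≠ isCombSeq_combHeight.tip}} (hg : g ∈ isCombSeq_combHeight.vertexSet) :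
    ∃ x : oscManifold m₁ m₂, IsCriticalPointOn (oscManifold m₁ m₂) (fun y => y 0) x ∧
      toComb m₁ m₂ x = g := by
  suffices h : ∃ d ∈ region, foldMap d = g.1.1 ∧
      ((d.1 - c₀ d.2 = 0 ∧ deriv c₀ d.2 = 0) ∨ (disk d.1 d.2 = 0 ∧ d.2 = 1 / (2 * π))) by
    obtain ⟨d, hd, hdg, hcrit⟩ := h
    obtain ⟨x, hx, rfl⟩ := exists_planePart_eq h₁ h₂ hd
    obtain ⟨hl, hr⟩ := mem_oscManifold_iff.1 hx
    refine ⟨⟨x, hx⟩, (isCriticalPointOn_iff hx).2 ?_, Subtype.ext hdg⟩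
    refine hcrit.imp (fun h => ⟨?_, h.2⟩) (fun h => ⟨?_, h.2⟩)
    · rw [h.1, eq_comm, sq_eq_zero_iff, norm_eq_zero] at hl
      exact hl
    · rw [h.1, eq_comm, sq_eq_zero_iff, norm_eq_zero] at hr
      exact hr
  have hhalf := half_lt_inv_pi
  rcases hg with ⟨_ | k, hk⟩ | ⟨k, hk⟩
  · refine ⟨(combHeight 0, 1 / (2 * π)), mem_region_iff.2 ⟨disk_combHeight.ge,
      (isCombSeq_combHeight.pos 0).le, ?_⟩, by rw [hk, foldMap_top],
      Or.inr ⟨disk_combHeight, rfl⟩⟩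
    exact (c₀_le_half (clampPi_mem _).1 (clampPi_mem _).2).trans half_lt_combHeight.le
  · refine ⟨(c₀ (peak k), peak k), ⟨(sub_self _).ge, disk_nonneg_of_mem ?_ ?_⟩,
      by rw [hk, foldMap_peak], Or.inl ⟨sub_self _, deriv_c₀_peak k⟩⟩
    · exact ⟨(c₀_peak_pos k).le, (c₀_peak_le_half k).trans hhalf.le⟩
    · exact ⟨(peak_pos k).le, (peak_mem k).2.le.trans (zeroPt_le k)⟩
  · have h0 : (0 : ℝ) - c₀ (zeroPt k) = 0 := by rw [c₀_zeroPt, sub_zero]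
    refine ⟨(0, zeroPt k), ⟨h0.ge, disk_nonneg_of_mem ?_ ?_⟩,
      by rw [hk, foldMap_zeroPt], Or.inl ⟨h0, deriv_c₀_zeroPt k⟩⟩
    · exact ⟨le_rfl, by positivity⟩
    · exact ⟨(zeroPt_pos k).le, zeroPt_le k⟩

variable (m₁ m₂) in
/-- The origin, as a point of the zero set of `eMap`. -/
noncomputable def origin : oscManifold m₁ m₂ := ⟨0, zero_mem_oscManifold m₁ m₂⟩

theorem toComb_ne_tip_iff {x : oscManifold m₁ m₂} :
    toComb m₁ m₂ x ≠ isCombSeq_combHeight.tip ↔ x ≠ origin m₁ m₂ := by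
  rw [Ne, toComb_eq_tip_iff, Ne, Subtype.ext_iff]
  rfl

theorem mem_image_reebMap_iff (h₁ : 1 < m₁) (h₂ : 1 < m₂) (s : ReebSpace (oscHeight m₁ m₂)) :
    s ∈ reebMap (oscHeight m₁ m₂) '' {x | x ≠ origin m₁ m₂} ↔
      reebHomeo h₁ h₂ s ≠ isCombSeq_combHeight.tip := by
  constructor
  · rintro ⟨x, hx, rfl⟩
    exact toComb_ne_tip_iff.2 hx
  · induction s using Quotient.inductionOn with
    | h x => exact fun h => ⟨x, toComb_ne_tip_iff.1 h, rfl⟩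

/-- The homeomorphism of the Reeb space with the comb, away from the origin and the tip. -/
noncomputable def reebHomeoSubtype (h₁ : 1 < m₁) (h₂ : 1 < m₂) :
    (reebMap (oscHeight m₁ m₂) '' {x | x ≠ origin m₁ m₂}) ≃ₜ
      {g : combSet combHeight // g ≠ isCombSeq_combHeight.tip} :=
  (reebHomeo h₁ h₂).subtype (mem_image_reebMap_iff h₁ h₂)

/-- The E-graph on the Reeb side is pulled back from the comb, which makes the isomorphism
automatic; the content is this description of its vertices. -/
theorem image_vertices_comap (h₁ : 1 < m₁) (h₂ : 1 < m₂) : Subtype.val ''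
    (isCombSeq_combHeight.eGraph.comap (reebHomeoSubtype h₁ h₂)).vertices =
      {s | ∃ x : oscManifold m₁ m₂, x ≠ origin m₁ m₂ ∧
        IsCriticalPointOn (oscManifold m₁ m₂) (fun y => y 0) x ∧
        reebMap (oscHeight m₁ m₂) x = s} := by
  ext s
  constructor
  · rintro ⟨s, hs, rfl⟩
    obtain ⟨x, hc, hx⟩ := exists_critical_of_mem_vertexSet h₁ h₂ hs
    refine ⟨x, toComb_ne_tip_iff.1 ?_, hc, ?_⟩
    · rw [hx]
      exact (reebHomeoSubtype h₁ h₂ s).2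
    · exact (reebHomeo h₁ h₂).injective hx
  · rintro ⟨x, hx, hc, rfl⟩
    exact ⟨⟨_, x, hx, rfl⟩, toComb_mem_vertexSet (toComb_ne_tip_iff.2 hx) hc, rfl⟩

end Vertices

theorem theorem2 :
    ∃ p₁ p₂ r₁ r₂ r₁₂ : ℝ, 0 < p₁ ∧ 0 < p₂ ∧ 0 < r₁ ∧ 0 < r₂ ∧ 0 < r₁₂ ∧
    ∃ (G : Type) (_ : TopologicalSpace G), IsPeanoContinuum G ∧
      ¬ HomeomorphicToEGraph.{u} G ∧
      ∃ (p : G) (Γ : EGraph {x : G // x ≠ p}),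
        -- the point `p` is the only one with an E-graph as its complement
        (∀ p' : G, HomeomorphicToEGraph.{u} {x : G // x ≠ p'} → p' = p) ∧
        -- `G` is the one-point compactification of the E-graph `G - {p}`
        NoncompactSpace {x : G // x ≠ p} ∧
        (∃ ψ : OnePoint {x : G // x ≠ p} ≃ₜ G,
          ψ OnePoint.infty = p ∧ ∀ x : {x : G // x ≠ p}, ψ (x : OnePoint _) = x) ∧
        ∀ m₁ m₂ : ℕ, 1 < m₁ → 1 < m₂ →
          ContDiff ℝ ∞ (eMap p₁ p₂ r₁ r₂ r₁₂ m₁ m₂) ∧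
          (∃ Z : Set (EuclideanSpace ℝ (Fin (m₁ + m₂ + 2))), volume Z = 0 ∧
            ∀ x ∉ Z, AnalyticAt ℝ (eMap p₁ p₂ r₁ r₂ r₁₂ m₁ m₂) x) ∧
          IsSmoothSubmanifold (m₁ + m₂) (zeroManifold p₁ p₂ r₁ r₂ r₁₂ m₁ m₂) ∧
          IsCompact (zeroManifold p₁ p₂ r₁ r₂ r₁₂ m₁ m₂) ∧
          IsConnected (zeroManifold p₁ p₂ r₁ r₂ r₁₂ m₁ m₂) ∧
          -- the Reeb space is homeomorphic to `G`
          ∃ h : ReebSpace (cFun p₁ p₂ r₁ r₂ r₁₂ m₁ m₂) ≃ₜ G,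
            -- the origin `o` lies on the manifold; the image of its complement under the quotient
            -- map is an E-graph whose vertices represent the critical contours
            ∃ o : zeroManifold p₁ p₂ r₁ r₂ r₁₂ m₁ m₂,
              (o : EuclideanSpace ℝ (Fin (m₁ + m₂ + 2))) = 0 ∧
              ∃ R : EGraph (reebMap (cFun p₁ p₂ r₁ r₂ r₁₂ m₁ m₂) '' {x | x ≠ o}),
                Subtype.val '' R.vertices = {s | ∃ x : zeroManifold p₁ p₂ r₁ r₂ r₁₂ m₁ m₂, x ≠ o ∧
                  IsCriticalPointOn (zeroManifold p₁ p₂ r₁ r₂ r₁₂ m₁ m₂) (fun y => y 0) x ∧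
                  reebMap (cFun p₁ p₂ r₁ r₂ r₁₂ m₁ m₂) x = s} ∧
                -- and `h` restricts to an isomorphism from this E-graph onto `G - {p}`
                ∃ φ : (reebMap (cFun p₁ p₂ r₁ r₂ r₁₂ m₁ m₂) '' {x | x ≠ o}) ≃ₜ {x : G // x ≠ p},
                  (∀ s, (φ s : G) = h s) ∧ R.IsIso Γ φ := by

  have hH := isCombSeq_combHeight
  refine ⟨1 / (2 * π), 1 / (2 * π), 1, 1, 1 / (2 * π ^ 2), by positivity, by positivity, one_pos,
    one_pos, by positivity, combSet combHeight, inferInstance, hH.isPeanoContinuum,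
    hH.not_homeomorphicToEGraph, hH.tip, hH.eGraph, hH.eq_tip_of_homeomorphicToEGraph,
    hH.noncompactSpace, hH.exists_onePoint_homeomorph, fun m₁ m₂ h₁ h₂ => ⟨contDiff_oscMap,
    ⟨{x | x 1 = 0}, volume_setOf_eq_zero _, fun x hx => analyticAt_oscMap hx⟩,
    isSmoothSubmanifold_oscManifold m₁ m₂, isCompact_oscManifold h₁ h₂,
    isConnected_oscManifold h₁ h₂, reebHomeo h₁ h₂, origin m₁ m₂, rfl,
    hH.eGraph.comap (reebHomeoSubtype h₁ h₂), image_vertices_comap h₁ h₂,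
    reebHomeoSubtype h₁ h₂, fun s => rfl, EGraph.comap_isIso _ _⟩⟩
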